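/- For a set $A\subseteq\mathbb{F}_2^n$, the Cayley sum graph generated by $A$ has vertex set $\mathbb{F}_2^n$, with distinct vertices $x\neq y$ joined if and only if $x+y\in A$ (since $x+y=x-y$ in $\mathbb{F}_2^n$, this is also the Cayley graph generated by $A$). Let $\chi_n$ denote the chromatic number of this graph when $A$ is a random subset of $\mathbb{F}_2^n$ that contains each element with probability $\frac12$, independently of the other elements. Write $\log$ for the logarithm to base $2$. Then there exists a strictly increasing sequence $(n_l)$ of integers $n_l\geq 2$ whose set of terms $S=\{n_l\}$ has natural density $1$, that is, $\lim_{N\to\infty}|S\cap\{1,\dots,N\}|/N=1$, such that $$\lim_{l\to\infty}\mathbb{P}\left(\chi_{n_l}=2^{\,n_l-\lfloor\log n_l+\log\log n_l\rfloor}\right)=1.$$ -/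

import Mathlib

open MeasureTheory ProbabilityTheory Filter Topology

/-- The Cayley sum graph on an abelian group `G` generated by the set `A`:
distinct vertices `x` and `y` are adjacent iff `x + y ∈ A`. -/
def cayleySumGraph {G : Type*} [AddCommGroup G] (A : Set G) : SimpleGraph G where
  Adj x y := x ≠ y ∧ x + y ∈ A
  symm := ⟨fun x y h => ⟨h.1.symm, by rw [add_comm]; exact h.2⟩⟩
  loopless := ⟨fun _ h => h.1 rfl⟩

/-- The law of a random subset of `𝔽₂ⁿ` that contains each element with probability `1/2`,
independently of the other elements. -/
noncomputable def randomSubset (n : ℕ) : Measure (Set (Fin n → ZMod 2)) :=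
  setBernoulli Set.univ ⟨1 / 2, by norm_num, by norm_num⟩

/-- The set `S` of natural numbers has natural density `d`:
`|S ∩ {1, …, N}| / N → d` as `N → ∞`. -/
def HasNaturalDensity (S : Set ℕ) (d : ℝ) : Prop :=
  Tendsto (fun N : ℕ => ((S ∩ Set.Icc 1 N).ncard : ℝ) / N) atTop (𝓝 d)

/-- `m(n) = ⌊log₂ n + log₂ log₂ n⌋`, used for `n ≥ 2`, where both logarithms are defined and
`0 ≤ log₂ n + log₂ log₂ n ≤ n`. -/
noncomputable def concentrationDim (n : ℕ) : ℕ :=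
  ⌊Real.logb 2 n + Real.logb 2 (Real.logb 2 n)⌋₊

/-- The exponent `n - m(n)` involves no truncation when `n ≥ 2`: `m(n)` is the integer floor. -/
theorem concentrationDim_spec (n : ℕ) (hn : 2 ≤ n) :
    (concentrationDim n : ℤ) = ⌊Real.logb 2 n + Real.logb 2 (Real.logb 2 n)⌋ ∧
      concentrationDim n ≤ n := by
  have h2 : (2 : ℝ) ≤ n := by exact_mod_cast hn
  have hlog : 1 ≤ Real.logb 2 n := by
    rw [Real.le_logb_iff_rpow_le (by norm_num) (by linarith)]; simpa using h2
  have hll : 0 ≤ Real.logb 2 (Real.logb 2 n) := Real.logb_nonneg (by norm_num) hlog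
  refine ⟨Int.natCast_floor_eq_floor (by linarith), ?_⟩
  have hle : Real.logb 2 n + Real.logb 2 (Real.logb 2 n) ≤ n := by
    rw [← Real.logb_mul (by positivity) (by positivity),
      Real.logb_le_iff_le_rpow (by norm_num) (by positivity), Real.rpow_natCast]
    have hlogle : Real.logb 2 n ≤ (n : ℝ) - 1 := by
      rw [Real.logb_le_iff_le_rpow (by norm_num) (by positivity)]
      obtain ⟨k, rfl⟩ : ∃ k, n = k + 1 := ⟨n - 1, by omega⟩
      push_cast
      rw [add_sub_cancel_right, Real.rpow_natCast]
      exact_mod_cast Nat.lt_two_pow_self (n := k)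
    have key : ∀ k : ℕ, 2 ≤ k → k * (k - 1) ≤ 2 ^ k := by
      intro k hk
      rcases Nat.lt_or_ge k 5 with h | h
      · interval_cases k <;> norm_num
      · have : k * k ≤ 2 ^ k := by
          induction k, h using Nat.le_induction with
          | base => norm_num
          | succ j hj ih => rw [pow_succ]; nlinarith [ih (by omega)]
        exact le_trans (Nat.mul_le_mul_left k (Nat.sub_le k 1)) this
    have hk : ((n * (n - 1) : ℕ) : ℝ) ≤ 2 ^ n := by exact_mod_cast key n hn
    rw [Nat.cast_mul, Nat.cast_sub (by omega), Nat.cast_one] at hk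
    exact le_trans (mul_le_mul_of_nonneg_left hlogle (by positivity)) hk
  unfold concentrationDim
  exact Nat.floor_le_of_le hle

/-! ### Sumsets and small doubling in elementary abelian 2-groups. -/

section Additive

open Finset
open scoped Pointwise

/-! Write m for `concentrationDim n`. A set X is independent exactly when the nonzero elements of X
+ X avoid A. If the nonzero elements of an m-dimensional subspace avoid A, its cosets are colour
classes, which gives the upper bound. Such a subspace exists with high probability by the second
moment method (`randomSubset_real_no_free_subspace_le`): two subspaces are correlated only through
their intersection, and m is chosen so that 2^m is at most n(m - 2), which leaves just enough room
even when the two coincide.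

For the lower bound it is enough that no X with 2^m + 1 elements is independent (`le_of_colorable`).
A given X is independent with probability at most 2 * 2^(-|X + X|), and the Hopf–Stiefel bound
(`two_pow_le_card_add`) makes |X + X| jump to at least 2^(m+1). What remains is a union bound,
`randomSubset_real_exists_sum_free_le`, for which such X must be counted economically. If σ = |X +
X| is at least 1024|X|, then X lies in the set of sum neighbours of a small subset
(`exists_subset_sumNeighbours`), and at most 7σ/8 bits describe it. If the doubling is below 1024,
then X spans only m + O(√m) dimensions (`finrank_span_le_of_card_add_le`), and naming the span costs
n(m + O(√m)) bits. Inside the span, either a small Y ⊆ X already has almost 2^(m+1) sums, and the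
union bound runs over Y, or X is recovered from two small subsets up to few corrections
(`exists_commonTranslates_approx`).

The second case needs n(m + O(√m)) ≤ 2^(m+1). Since nm ≤ (1 + o(1)) 2^(m+1) always holds, the
condition fails only for n in windows of relative width o(1) around 2^(M+1)/M. These windows have
density zero (`hasNaturalDensity_gap`). -/

theorem zmod_two_add_add_cancel {G : Type*} [AddCommGroup G] [Module (ZMod 2) G] (x y : G) :
    x + (x + y) = y := by
  rw [← add_assoc, ZModModule.add_self, zero_add]

/-- Greedy choice of few translates of `X` that almost contain every translate of `X` by one of
its elements. -/
theorem exists_almost_closing_subset {G : Type*} [AddCommGroup G] [DecidableEq G]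
    (X : Finset G) (K D : ℕ) (hX : #(X + X) ≤ K * #X) (hne : X.Nonempty) : ∃ F ⊆ X, #F ≤ K * D ∧
      ∀ x ∈ X, D * #(X.filter (fun y => x + y ∉ F + X)) < #X := by
  classical
  -- Take F maximal among the sets whose elements each contribute |X|/D new sums on average. An x
  -- violating the conclusion would contribute that many and could be added.
  obtain ⟨F, hF, hmax⟩ := exists_max_image (X.powerset.filter (fun F => #F * #X ≤ D * #(F + X)))
    (fun F => #F) ⟨∅, by simp⟩
  rw [mem_filter, mem_powerset] at hF
  have hXpos := hne.card_pos
  refine ⟨F, hF.1, ?_, ?_⟩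
  · have h1 : #(F + X) ≤ #(X + X) := card_le_card (add_subset_add_right hF.1)
    refine Nat.le_of_mul_le_mul_right (hF.2.trans ?_) hXpos
    calc D * #(F + X) ≤ D * (K * #X) := Nat.mul_le_mul_left _ (h1.trans hX)
      _ = K * D * #X := by ring
  · intro x hx
    by_cases hxF : x ∈ F
    · have : X.filter (fun y => x + y ∉ F + X) = ∅ := by
        rw [filter_eq_empty_iff]
        intro y hy
        simpa using add_mem_add hxF hy
      simpa [this] using hXpos
    · by_contra! hcon
      have hle : #(F + X) + #(X.filter (fun y => x + y ∉ F + X)) ≤ #(insert x F + X) := by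
        rw [← card_image_of_injective (X.filter (fun y => x + y ∉ F + X)) (add_right_injective x),
          ← card_union_of_disjoint]
        · apply card_le_card
          apply union_subset (add_subset_add_right (subset_insert _ _))
          intro z hz
          obtain ⟨y, hy, rfl⟩ := mem_image.1 hz
          exact add_mem_add (mem_insert_self _ _) (mem_filter.1 hy).1
        · rw [disjoint_right]
          intro z hz
          obtain ⟨y, hy, rfl⟩ := mem_image.1 hz
          exact (mem_filter.1 hy).2
      have := hmax (insert x F) (by
        rw [mem_filter, mem_powerset, card_insert_of_notMem hxF]
        refine ⟨insert_subset hx hF.1, ?_⟩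
        calc (#F + 1) * #X = #F * #X + #X := by ring
          _ ≤ D * #(F + X) + D * #(X.filter (fun y => x + y ∉ F + X)) := by
            exact Nat.add_le_add hF.2 hcon
          _ ≤ D * #(insert x F + X) := by rw [← mul_add]; exact Nat.mul_le_mul_left _ hle)
      simp only [card_insert_of_notMem hxF] at this
      omega

variable {G : Type*} [AddCommGroup G] [Module (ZMod 2) G] [DecidableEq G]

/-- A power-of-two instance of the Hopf–Stiefel bound for sumsets in elementary abelian
`2`-groups. -/
theorem two_pow_le_card_add (m : ℕ) : ∀ A B : Finset G, A.Nonempty → B.Nonempty →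
    2 ^ m + 1 ≤ #A + #B → 2 ^ m ≤ #(A + B) := by
  induction m with
  | zero =>
    intro A B hA hB _
    simpa using (hA.add hB).card_pos
  | succ m ih =>
    intro A B hA hB h
    -- With A the smaller set, B has more than 2^m elements, which settles the cases where A is a
    -- point or B lies on one side of a hyperplane.
    wlog hAB : #A ≤ #B generalizing A B
    · rw [add_comm A B]
      exact this B A hB hA (by omega) (by omega)
    rcases hA.exists_eq_singleton_or_nontrivial with ⟨a, rfl⟩ | ⟨a, ha, a', ha', hne⟩
    · rw [singleton_add, card_vadd_finset]
      rw [card_singleton] at h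
      omega
    -- The functional splits the smaller set properly. Each fibre of A + B contains two sums of
    -- halves, whose sizes total |A| + |B|, so one of the two pairs satisfies the induction
    -- hypothesis.
    obtain ⟨φ, hφ⟩ : ∃ φ : Module.Dual (ZMod 2) G, φ (a - a') ≠ 0 := by
      by_contra! hc
      exact hne (sub_eq_zero.1 ((Module.forall_dual_apply_eq_zero_iff (ZMod 2) _).1 hc))
    have key : ∀ C : Finset G, #C = #(C.filter (fun x => φ x = 0)) +
        #(C.filter (fun x => φ x = 1)) := by
      intro C
      rw [← card_filter_add_card_filter_not (fun x => φ x = 0)]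
      congr 2
      ext x
      simp only [mem_filter, and_congr_right_iff]
      intro _
      generalize φ x = c
      revert c; decide
    have hmem : ∀ i j : ZMod 2, A.filter (fun x => φ x = i) + B.filter (fun x => φ x = j) ⊆
        (A + B).filter (fun x => φ x = i + j) := by
      intro i j x hx
      obtain ⟨y, hy, z, hz, rfl⟩ := mem_add.1 hx
      rw [mem_filter] at hy hz ⊢
      exact ⟨add_mem_add hy.1 hz.1, by rw [map_add, hy.2, hz.2]⟩
    have hAne : ∀ i : ZMod 2, (A.filter (fun x => φ x = i)).Nonempty := by
      have h2 : ∀ u v i : ZMod 2, u - v ≠ 0 → i = u ∨ i = v := by decide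
      intro i
      rw [map_sub] at hφ
      rcases h2 _ _ i hφ with h | h
      · exact ⟨a, mem_filter.2 ⟨ha, h.symm⟩⟩
      · exact ⟨a', mem_filter.2 ⟨ha', h.symm⟩⟩
    have step : ∀ i j : ZMod 2, 2 ^ m + 1 ≤
        #(A.filter (fun x => φ x = i)) + #(B.filter (fun x => φ x = j)) →
        (B.filter (fun x => φ x = j)).Nonempty →
        2 ^ m ≤ #((A + B).filter (fun x => φ x = i + j)) := fun i j h1 h2 =>
      (ih _ _ (hAne i) h2 h1).trans (card_le_card (hmem i j))
    have hkA := key A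
    have hkB := key B
    have e11 : (1 : ZMod 2) + 1 = 0 := by decide
    have p0 := (hAne 0).card_pos
    have p1 := (hAne 1).card_pos
    rw [key (A + B)]
    have s00 := step 0 0
    have s01 := step 0 1
    have s10 := step 1 0
    have s11 := step 1 1
    rw [e11] at s11
    simp only [zero_add, add_zero] at s00 s01 s10
    rw [pow_succ] at h ⊢
    rcases (B.filter (fun x => φ x = 0)).eq_empty_or_nonempty with h0 | h0
    · have h1 : (B.filter (fun x => φ x = 1)).Nonempty := by
        rw [← card_pos]; rw [h0, card_empty] at hkB; have := hB.card_pos; omega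
      rw [h0, card_empty] at hkB
      have := s01 (by omega) h1
      have := s11 (by omega) h1
      omega
    rcases (B.filter (fun x => φ x = 1)).eq_empty_or_nonempty with h1 | h1
    · rw [h1, card_empty] at hkB
      have := s00 (by omega) h0
      have := s10 (by omega) h0
      omega
    · have q0 : 2 ^ m ≤ #((A + B).filter (fun x => φ x = 0)) := by
        by_cases hc : 2 ^ m + 1 ≤
          #(A.filter (fun x => φ x = 0)) + #(B.filter (fun x => φ x = 0))
        · exact s00 hc h0
        · exact s11 (by omega) h1
      have q1 : 2 ^ m ≤ #((A + B).filter (fun x => φ x = 1)) := by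
        by_cases hc : 2 ^ m + 1 ≤
          #(A.filter (fun x => φ x = 0)) + #(B.filter (fun x => φ x = 1))
        · exact s01 hc h1
        · exact s10 (by omega) h0
      omega

/-- The jump behind the lower bound: a subspace of size 2^m has 2^m sums, but a single further
element forces twice as many. -/
theorem two_pow_succ_le_card_add_self {m : ℕ} {X : Finset G} (h : 2 ^ m < #X) :
    2 ^ (m + 1) ≤ #(X + X) := by
  have hne : X.Nonempty := card_pos.1 (Nat.zero_lt_of_lt h)
  exact two_pow_le_card_add _ _ _ hne hne (by rw [pow_succ]; omega)

variable [Finite G]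

/-- A set of small doubling that contains `0` has at least half of its elements in a subspace of
small dimension. -/
theorem exists_submodule_half (X : Finset G) (h0 : 0 ∈ X) (K D : ℕ) (hD : 3 ≤ D)
    (hX : #(X + X) ≤ K * #X) :
    ∃ (V : Submodule (ZMod 2) G) (Y : Finset G) (R : ℕ), Y ⊆ X ∧ (∀ y, y ∈ Y ↔ y ∈ X ∧ y ∈ V) ∧
      Module.finrank (ZMod 2) V ≤ K * D + R ∧
      (2 * D - 2) ^ R ≤ #X * D ^ R ∧ #X ≤ 2 * #Y := by
  classical
  obtain ⟨F, hFX, hFcard, hF⟩ := exists_almost_closing_subset X K D hX ⟨0, h0⟩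
  set W := Submodule.span (ZMod 2) (F : Set G) with hW
  have hWF : Module.finrank (ZMod 2) W ≤ K * D := (finrank_span_finset_le_card F).trans hFcard
  let π := W.mkQ
  have hπ : ∀ x y, π x = π y ↔ x + y ∈ W := by
    intro x y
    rw [← ZModModule.sub_eq_add]
    exact Submodule.Quotient.eq W
  -- Potential function: the number of cosets of W met by X ∩ V. While V holds less than half of X,
  -- one more dimension multiplies it by at least (2D - 2)/D; it never exceeds |X|, so a last R
  -- exists.
  let c : Submodule (ZMod 2) G → ℕ := fun V => #((X.filter (fun x => x ∈ V)).image π)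
  have hc : ∀ V, c V ≤ #X := fun V => card_image_le.trans (card_filter_le _ _)
  let P : ℕ → Prop := fun R => ∃ V : Submodule (ZMod 2) G, W ≤ V ∧
    Module.finrank (ZMod 2) V ≤ K * D + R ∧ (2 * D - 2) ^ R ≤ c V * D ^ R
  have hP0 : P 0 := by
    refine ⟨W, le_rfl, hWF, ?_⟩
    have : 0 < c W := by
      apply card_pos.2
      exact ⟨π 0, mem_image_of_mem _ (mem_filter.2 ⟨h0, W.zero_mem⟩)⟩
    simpa [Nat.one_le_iff_ne_zero] using this.ne'
  obtain ⟨R, hR, hR1⟩ : ∃ R, P R ∧ ¬ P (R + 1) := by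
    by_contra! hcon
    have hall : ∀ R, P R := fun R => Nat.rec hP0 (fun R h => hcon R h) R
    have hDpos : 0 < D := by omega
    have hgt : (1 : ℝ) < (2 * D - 2) / D := by
      rw [lt_div_iff₀ (by positivity)]
      have : (3 : ℝ) ≤ D := by exact_mod_cast hD
      linarith
    obtain ⟨R, hR⟩ := pow_unbounded_of_one_lt (#X : ℝ) hgt
    obtain ⟨V, -, -, h⟩ := hall R
    have h' : (2 * D - 2) ^ R ≤ #X * D ^ R := h.trans (Nat.mul_le_mul_right _ (hc V))
    have h'' : ((2 * D - 2 : ℝ)) ^ R ≤ #X * D ^ R := by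
      have : ((2 * D - 2 : ℕ) : ℝ) = 2 * D - 2 := by
        rw [Nat.cast_sub (by omega)]; push_cast; ring
      rw [← this]
      exact_mod_cast h'
    rw [div_pow, lt_div_iff₀ (by positivity)] at hR
    linarith
  obtain ⟨V, hWV, hV, hcV⟩ := hR
  refine ⟨V, X.filter (fun x => x ∈ V), R, filter_subset _ _, fun y => mem_filter, hV,
    hcV.trans (Nat.mul_le_mul_right _ (hc V)), ?_⟩
  by_contra! hhalf
  apply hR1
  set D0 := (X.filter (fun x => x ∈ V)).image π with hD0
  set O := X.filter (fun x => x ∉ V) with hO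
  have hsplit : #(X.filter (fun x => x ∈ V)) + #O = #X :=
    card_filter_add_card_filter_not (fun x => x ∈ V)
  have hOpos : 0 < #O := by omega
  have hbad : ∀ d ∈ D0, D * #(O.filter (fun x => d + π x ∉ X.image π)) < #X := by
    intro d hd
    obtain ⟨x0, hx0, rfl⟩ := mem_image.1 hd
    refine lt_of_le_of_lt (Nat.mul_le_mul_left _ (card_le_card ?_)) (hF x0 (mem_filter.1 hx0).1)
    intro x hx
    rw [mem_filter] at hx ⊢
    refine ⟨(mem_filter.1 hx.1).1, fun hmem => hx.2 ?_⟩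
    obtain ⟨f, hf, y, hy, hfy⟩ := mem_add.1 hmem
    refine mem_image.2 ⟨y, hy, ?_⟩
    have hf0 : π f = 0 := (Submodule.Quotient.mk_eq_zero W).2 (Submodule.subset_span hf)
    rw [← map_add, ← hfy, map_add, hf0, zero_add]
  -- Double counting: each coset d fails for fewer than |X|/D elements of X, and O has more than
  -- |X|/2 elements, so some x in O fails for at most a 2/D fraction of the cosets.
  have hgood : ∃ x ∈ O, (D - 2) * #D0 ≤ D * #(D0.filter (fun d => d + π x ∈ X.image π)) := by
    by_contra! hcon
    have h1 : ∑ x ∈ O, D * #(D0.filter (fun d => d + π x ∈ X.image π)) <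
        ∑ x ∈ O, (D - 2) * #D0 := sum_lt_sum_of_nonempty (card_pos.1 hOpos) hcon
    rw [sum_const, smul_eq_mul, ← mul_sum] at h1
    have h2 : ∑ x ∈ O, #(D0.filter (fun d => d + π x ∈ X.image π)) =
        ∑ d ∈ D0, #(O.filter (fun x => d + π x ∈ X.image π)) := by
      simp only [card_filter]
      exact sum_comm
    rw [h2, mul_sum] at h1
    have h3 : ∑ d ∈ D0, (D - 2) * #O ≤
        ∑ d ∈ D0, D * #(O.filter (fun x => d + π x ∈ X.image π)) := by
      apply sum_le_sum
      intro d hd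
      have e1 := card_filter_add_card_filter_not (s := O) (fun x => d + π x ∈ X.image π)
      have e2 := hbad d hd
      obtain ⟨D', rfl⟩ : ∃ D', D = D' + 2 := ⟨D - 2, by omega⟩
      rw [Nat.add_sub_cancel]
      nlinarith
    rw [sum_const, smul_eq_mul] at h3
    have : #D0 * ((D - 2) * #O) = #O * ((D - 2) * #D0) := by ring
    omega
  obtain ⟨x, hx, hxg⟩ := hgood
  have hxV : x ∉ V := (mem_filter.1 hx).2
  have hVne : ∀ v ∈ D0, ∃ y ∈ V, π y = v := by
    intro v hv
    obtain ⟨y, hy, rfl⟩ := mem_image.1 hv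
    exact ⟨y, (mem_filter.1 hy).2, rfl⟩
  refine ⟨V ⊔ Submodule.span (ZMod 2) {x}, hWV.trans le_sup_left, ?_, ?_⟩
  · have := Submodule.finrank_add_le_finrank_add_finrank V (Submodule.span (ZMod 2) {x})
    have h1 := finrank_span_le_card (R := ZMod 2) ({x} : Set G)
    simp only [Set.toFinset_singleton, card_singleton] at h1
    omega
  · have hcle : #D0 + #(D0.filter (fun d => d + π x ∈ X.image π)) ≤
        c (V ⊔ Submodule.span (ZMod 2) {x}) := by
      rw [← card_image_of_injective (D0.filter _) (add_left_injective (π x)),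
        ← card_union_of_disjoint]
      · apply card_le_card
        apply union_subset
        · apply image_subset_image
          intro y hy
          rw [mem_filter] at hy ⊢
          exact ⟨hy.1, Submodule.mem_sup_left hy.2⟩
        · intro z hz
          obtain ⟨d, hd, rfl⟩ := mem_image.1 hz
          rw [mem_filter] at hd
          obtain ⟨y, hy, hyd⟩ := mem_image.1 hd.2
          obtain ⟨v, hv, rfl⟩ := hVne d hd.1
          refine mem_image.2 ⟨y, mem_filter.2 ⟨hy, ?_⟩, hyd⟩
          rw [← map_add, hπ] at hyd
          have : y = (y + (v + x)) + (v + x) := by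
            rw [add_assoc, ZModModule.add_self, add_zero]
          rw [this]
          refine Submodule.add_mem _ (Submodule.mem_sup_left (hWV hyd)) ?_
          exact Submodule.add_mem_sup hv (Submodule.mem_span_singleton_self x)
      · rw [disjoint_right]
        intro z hz hz'
        obtain ⟨d, hd, rfl⟩ := mem_image.1 hz
        obtain ⟨v, hv, rfl⟩ := hVne d (mem_filter.1 hd).1
        obtain ⟨v', hv', h⟩ := hVne _ hz'
        rw [← map_add, hπ] at h
        apply hxV
        have : x = v + (v' + (v' + (v + x))) := by
          rw [zmod_two_add_add_cancel, zmod_two_add_add_cancel]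
        rw [this]
        exact V.add_mem hv (V.add_mem hv' (hWV h))
    calc (2 * D - 2) ^ (R + 1) = (2 * D - 2) ^ R * (2 * D - 2) := pow_succ _ _
      _ ≤ (#D0 * D ^ R) * (2 * D - 2) := Nat.mul_le_mul_right _ hcV
      _ = D ^ R * (D * #D0 + (D - 2) * #D0) := by
        obtain ⟨D', rfl⟩ : ∃ D', D = D' + 2 := ⟨D - 2, by omega⟩
        rw [show 2 * (D' + 2) - 2 = D' + 2 + D' by omega, Nat.add_sub_cancel]
        ring
      _ ≤ D ^ R * (D * #D0 + D * #(D0.filter (fun d => d + π x ∈ X.image π))) :=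
        Nat.mul_le_mul_left _ (Nat.add_le_add_left hxg _)
      _ = D ^ (R + 1) * (#D0 + #(D0.filter (fun d => d + π x ∈ X.image π))) := by ring
      _ ≤ D ^ (R + 1) * c (V ⊔ Submodule.span (ZMod 2) {x}) := Nat.mul_le_mul_left _ hcle
      _ = _ := by ring

/-- A set of small doubling that contains `0` spans a subspace of small dimension. -/
theorem finrank_span_le_of_card_add_le (X : Finset G) (h0 : 0 ∈ X) (K D : ℕ) (hD : 3 ≤ D)
    (hX : #(X + X) ≤ K * #X) :
    ∃ R : ℕ, Module.finrank (ZMod 2) (Submodule.span (ZMod 2) (X : Set G)) ≤ K * D + R + 2 * K ∧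
      (2 * D - 2) ^ R ≤ #X * D ^ R := by
  classical
  obtain ⟨V, Y, R, hYX, hY, hV, hR, hhalf⟩ := exists_submodule_half X h0 K D hD hX
  refine ⟨R, ?_, hR⟩
  have hXpos : 0 < #X := card_pos.2 ⟨0, h0⟩
  have hrep : ∀ d ∈ X.image V.mkQ, ∃ x ∈ X, V.mkQ x = d := fun d hd => mem_image.1 hd
  choose! r hrX hr using hrep
  -- Translates of Y ⊆ V by representatives of distinct cosets are disjoint. As Y is at least half
  -- of X, the set X meets at most 2K cosets of V.
  have hcard : #(X.image V.mkQ) * #Y ≤ #(X + X) := by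
    rw [← card_product]
    apply card_le_card_of_injOn (fun p => r p.1 + p.2)
    · rintro ⟨d, y⟩ hp
      rw [mem_coe, mem_product] at hp
      exact add_mem_add (hrX d hp.1) (hYX hp.2)
    · rintro ⟨d, y⟩ hp ⟨d', y'⟩ hp' h
      rw [mem_coe, mem_product] at hp hp'
      simp only at h hp hp'
      have hy : V.mkQ y = 0 := (Submodule.Quotient.mk_eq_zero V).2 ((hY y).1 hp.2).2
      have hy' : V.mkQ y' = 0 := (Submodule.Quotient.mk_eq_zero V).2 ((hY y').1 hp'.2).2
      have hd : d = d' := by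
        have := congrArg V.mkQ h
        rwa [map_add, map_add, hy, hy', add_zero, add_zero, hr d hp.1, hr d' hp'.1] at this
      subst hd
      simpa using h
  have hN : #(X.image V.mkQ) ≤ 2 * K := by
    refine Nat.le_of_mul_le_mul_right ?_ hXpos
    nlinarith [Nat.zero_le #(X.image V.mkQ)]
  have hspan : Submodule.span (ZMod 2) (X : Set G) ≤
      V ⊔ Submodule.span (ZMod 2) (((X.image V.mkQ).image r : Finset G) : Set G) := by
    rw [Submodule.span_le]
    intro x hx
    have hxd := mem_image_of_mem V.mkQ (mem_coe.1 hx)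
    have h1 : r (V.mkQ x) + x ∈ V := by
      rw [← ZModModule.sub_eq_add]
      exact (Submodule.Quotient.eq V).1 (hr _ hxd)
    have h2 : x = (r (V.mkQ x) + x) + r (V.mkQ x) := by
      rw [add_comm, zmod_two_add_add_cancel]
    rw [h2]
    exact Submodule.add_mem_sup h1 (Submodule.subset_span (mem_coe.2 (mem_image_of_mem _ hxd)))
  have h1 := Submodule.finrank_mono hspan
  have h2 := Submodule.finrank_add_le_finrank_add_finrank V
    (Submodule.span (ZMod 2) (((X.image V.mkQ).image r : Finset G) : Set G))
  have h3 : Module.finrank (ZMod 2)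
      (Submodule.span (ZMod 2) (((X.image V.mkQ).image r : Finset G) : Set G)) ≤ _ :=
    finrank_span_finset_le_card (R := ZMod 2) ((X.image V.mkQ).image r)
  have h4 : #((X.image V.mkQ).image r) ≤ _ := card_image_le
  omega

end Additive

/-! ### Greedy hitting sets. -/

section Hitting

open Finset

variable {α ι : Type*} [DecidableEq α]

/-- By averaging, some point lies in at least a t/|X| fraction of the sets. Choosing it repeatedly
shrinks the number of missed sets by the factor 1 - t/|X|. -/
theorem exists_hitting_set_of_mul_pow_lt (X : Finset α) (S : ι → Finset α) (t : ℕ) (h : ℕ) :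
    ∀ I : Finset ι, (∀ i ∈ I, S i ⊆ X ∧ t ≤ #(S i)) → #I * (#X - t) ^ h < #X ^ h →
      ∃ H ⊆ X, #H ≤ h ∧ ∀ i ∈ I, (H ∩ S i).Nonempty := by
  classical
  induction h with
  | zero =>
    intro I _ hI
    have : I = ∅ := by simpa using hI
    exact ⟨∅, by simp [this]⟩
  | succ h ih =>
    intro I hS hI
    rcases I.eq_empty_or_nonempty with rfl | hne
    · exact ⟨∅, by simp⟩
    have hk : 0 < #X := by
      rcases Nat.eq_zero_or_pos #X with h0 | h0
      · simp [h0] at hI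
      · exact h0
    have htk : t ≤ #X := by
      obtain ⟨i, hi⟩ := hne
      exact (hS i hi).2.trans (card_le_card (hS i hi).1)
    obtain ⟨x, hx, hxI⟩ : ∃ x ∈ X, #I * t ≤ #X * #(I.filter (fun i => x ∈ S i)) := by
      by_contra! hcon
      have h1 := sum_lt_sum_of_nonempty (card_pos.1 hk) hcon
      rw [sum_const, smul_eq_mul, ← mul_sum] at h1
      have h2 : ∑ x ∈ X, #(I.filter (fun i => x ∈ S i)) = ∑ i ∈ I, #(S i) := by
        simp only [card_filter]
        rw [sum_comm]
        refine sum_congr rfl fun i hi => ?_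
        rw [← card_filter, filter_mem_eq_inter, inter_eq_right.2 (hS i hi).1]
      have h3 : #I * t ≤ ∑ i ∈ I, #(S i) := by
        rw [← smul_eq_mul, ← sum_const]
        exact sum_le_sum fun i hi => (hS i hi).2
      rw [h2] at h1
      exact absurd (Nat.lt_of_mul_lt_mul_left h1) (by omega)
    have hsplit := card_filter_add_card_filter_not (s := I) (fun i => x ∈ S i)
    obtain ⟨H, hHX, hH, hhit⟩ := ih (I.filter (fun i => x ∉ S i))
      (fun i hi => hS i (mem_filter.1 hi).1) (by
        have h1 : #X * #(I.filter (fun i => x ∉ S i)) ≤ #I * (#X - t) := by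
          rw [Nat.mul_sub]
          apply Nat.le_sub_of_add_le
          calc #X * #(I.filter (fun i => x ∉ S i)) + #I * t
              ≤ #X * #(I.filter (fun i => x ∉ S i)) + #X * #(I.filter (fun i => x ∈ S i)) :=
                Nat.add_le_add_left hxI _
            _ = #I * #X := by rw [← mul_add, add_comm, hsplit, mul_comm]
        refine Nat.lt_of_mul_lt_mul_left (a := #X) ?_
        calc #X * (#(I.filter (fun i => x ∉ S i)) * (#X - t) ^ h)
            = #X * #(I.filter (fun i => x ∉ S i)) * (#X - t) ^ h := by ring
          _ ≤ #I * (#X - t) * (#X - t) ^ h := Nat.mul_le_mul_right _ h1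
          _ = #I * (#X - t) ^ (h + 1) := by ring
          _ < #X ^ (h + 1) := hI
          _ = #X * #X ^ h := by ring)
    refine ⟨insert x H, insert_subset hx hHX, (card_insert_le _ _).trans (by omega), ?_⟩
    intro i hi
    by_cases hxi : x ∈ S i
    · exact ⟨x, mem_inter.2 ⟨mem_insert_self _ _, hxi⟩⟩
    · obtain ⟨y, hy⟩ := hhit i (mem_filter.2 ⟨hi, hxi⟩)
      exact ⟨y, mem_inter.2 ⟨mem_insert_of_mem (mem_inter.1 hy).1, (mem_inter.1 hy).2⟩⟩

theorem two_pow_mul_sub_pow_le {k t h c : ℕ} (htk : t ≤ k) (hk : 0 < k) (hth : c * k ≤ t * h) :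
    2 ^ c * (k - t) ^ h ≤ k ^ h := by
  have hk' : (0 : ℝ) < k := by exact_mod_cast hk
  have h1 : (1 - t / k : ℝ) ^ h ≤ Real.exp (-(c : ℝ)) := by
    have h2 : (0 : ℝ) ≤ 1 - t / k := by
      rw [sub_nonneg, div_le_one hk']
      exact_mod_cast htk
    calc (1 - t / k : ℝ) ^ h ≤ Real.exp (-(t / k)) ^ h :=
          pow_le_pow_left₀ h2 (Real.one_sub_le_exp_neg _) _
      _ = Real.exp (-(t * h / k)) := by
          rw [← Real.exp_nat_mul]
          congr 1
          ring
      _ ≤ Real.exp (-(c : ℝ)) := by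
          apply Real.exp_le_exp.2
          rw [neg_le_neg_iff, le_div_iff₀ hk']
          exact_mod_cast hth
  have h3 : (2 : ℝ) ^ c ≤ Real.exp c := by
    rw [← mul_one (c : ℝ), Real.exp_nat_mul]
    exact pow_le_pow_left₀ (by norm_num) (by linarith [Real.add_one_le_exp (1 : ℝ)]) _
  have h4 : (2 : ℝ) ^ c * (1 - t / k : ℝ) ^ h ≤ 1 := by
    calc (2 : ℝ) ^ c * (1 - t / k : ℝ) ^ h ≤ 2 ^ c * Real.exp (-(c : ℝ)) := by gcongr
      _ ≤ Real.exp c * Real.exp (-(c : ℝ)) := by gcongr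
      _ = 1 := by rw [← Real.exp_add]; simp
  have h5 : (1 - t / k : ℝ) = ((k - t : ℕ) : ℝ) / k := by
    rw [Nat.cast_sub htk]; field_simp
  rw [h5, div_pow, mul_div_assoc', div_le_one (by positivity)] at h4
  exact_mod_cast h4

/-- Greedy hitting sets: few points meet all members of a family of dense subsets of `X`. -/
theorem exists_hitting_set (X : Finset α) (I : Finset ι) (S : ι → Finset α) {t h c : ℕ}
    (ht : 0 < t) (hS : ∀ i ∈ I, S i ⊆ X ∧ t ≤ #(S i)) (hI : #I < 2 ^ c)
    (hth : c * #X ≤ t * h) :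
    ∃ H ⊆ X, #H ≤ h ∧ ∀ i ∈ I, (H ∩ S i).Nonempty := by
  rcases I.eq_empty_or_nonempty with rfl | ⟨i, hi⟩
  · exact ⟨∅, by simp⟩
  have htk : t ≤ #X := (hS i hi).2.trans (card_le_card (hS i hi).1)
  have hk : 0 < #X := by omega
  apply exists_hitting_set_of_mul_pow_lt X S t h I hS
  have h1 := two_pow_mul_sub_pow_le htk hk hth
  rcases Nat.eq_zero_or_pos ((#X - t) ^ h) with h0 | h0
  · rw [h0, mul_zero]
    positivity
  · exact lt_of_lt_of_le (Nat.mul_lt_mul_of_pos_right hI h0) h1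

/-- Hitting sets are taken for what is left of the family after deleting the points already chosen;
the surplus a * h in the sizes keeps t points in every set. -/
theorem exists_multi_hitting_set (X : Finset α) (I : Finset ι) (S : ι → Finset α) {t h c : ℕ}
    (ht : 0 < t) (hI : #I < 2 ^ c) (hth : c * #X ≤ t * h) (a : ℕ)
    (hS : ∀ i ∈ I, S i ⊆ X ∧ t + a * h ≤ #(S i)) :
    ∃ A ⊆ X, #A ≤ a * h ∧ ∀ i ∈ I, a ≤ #(A ∩ S i) := by
  induction a with
  | zero => exact ⟨∅, by simp⟩
  | succ a ih =>
    have ha : (a + 1) * h = a * h + h := by ring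
    obtain ⟨A, hAX, hA, hAS⟩ := ih fun i hi => ⟨(hS i hi).1, by have := (hS i hi).2; omega⟩
    obtain ⟨H, hHX, hH, hhit⟩ := exists_hitting_set X I (fun i => S i \ A) ht (by
      intro i hi
      refine ⟨sdiff_subset.trans (hS i hi).1, ?_⟩
      have h1 := le_card_sdiff A (S i)
      have h2 := (hS i hi).2
      omega) hI hth
    refine ⟨A ∪ H, union_subset hAX hHX, (card_union_le _ _).trans (by omega), ?_⟩
    intro i hi
    obtain ⟨y, hy⟩ := hhit i hi
    rw [Finset.mem_inter, Finset.mem_sdiff] at hy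
    have : insert y (A ∩ S i) ⊆ (A ∪ H) ∩ S i := by
      intro z hz
      rw [mem_insert] at hz
      rcases hz with rfl | hz
      · exact mem_inter.2 ⟨mem_union_right _ hy.1, hy.2.1⟩
      · exact mem_inter.2 ⟨mem_union_left _ (mem_inter.1 hz).1, (mem_inter.1 hz).2⟩
    have h1 := card_le_card this
    rw [card_insert_of_notMem (fun hc => hy.2.2 (mem_inter.1 hc).1)] at h1
    have := hAS i hi
    omega

end Hitting

/-! ### Recovering a set from few of its elements. -/

section Structure

open Finset
open scoped Pointwise

/-- The elements `z` such that at least `d` elements of `z + Y` lie in `Y + Y`. -/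
def sumNeighbours {G : Type*} [AddCommGroup G] [DecidableEq G] (d : ℕ) (Y : Finset G) :
    Finset G :=
  ((Y + Y) + Y).filter (fun z => d ≤ #(Y.filter (fun y => z + y ∈ Y + Y)))

/-- Count pairs (z, y) with z + y ∈ Y + Y: every y admits at most |Y + Y| values of z. -/
theorem mul_card_sumNeighbours_le {G : Type*} [AddCommGroup G] [DecidableEq G] (d : ℕ)
    (Y : Finset G) : d * #(sumNeighbours d Y) ≤ #Y * #(Y + Y) := by
  have h1 : d * #(sumNeighbours d Y) ≤
      ∑ z ∈ sumNeighbours d Y, #(Y.filter (fun y => z + y ∈ Y + Y)) := by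
    rw [mul_comm, ← smul_eq_mul, ← sum_const]
    exact sum_le_sum fun z hz => (mem_filter.1 hz).2
  refine h1.trans ?_
  simp only [card_filter]
  rw [sum_comm, ← smul_eq_mul, ← sum_const]
  refine sum_le_sum fun y _ => ?_
  rw [← card_filter]
  refine card_le_card_of_injOn (fun z => z + y) (fun z hz => (mem_filter.1 hz).2) ?_
  exact fun z _ z' _ h => add_left_injective y h

variable {G : Type*} [AddCommGroup G] [Module (ZMod 2) G] [DecidableEq G]

/-- The sumset of a small subset of `X` covers all elements with many representations in `X + X`. -/
theorem exists_subset_covering_popular (X P : Finset G) {t a h₁ h₂ c : ℕ}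
    (ht : 0 < t) (ha : 0 < a) (hP : ∀ w ∈ P, t + a * h₁ ≤ #(X.filter (fun y => w + y ∈ X)))
    (hPc : #P < 2 ^ c) (h1 : c * #X ≤ t * h₁) (h2 : c * #X ≤ a * h₂) :
    ∃ Y ⊆ X, #Y ≤ a * h₁ + h₂ ∧ P ⊆ Y + Y := by
  -- Two rounds: A contains at least a summands of every popular w, so the partners w + y of these
  -- form a set of size at least a, which B then hits.
  obtain ⟨A, hAX, hA, hAS⟩ := exists_multi_hitting_set X P
    (fun w => X.filter (fun y => w + y ∈ X)) ht hPc h1 a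
    (fun w hw => ⟨filter_subset _ _, hP w hw⟩)
  obtain ⟨B, hBX, hB, hBS⟩ := exists_hitting_set X P
    (fun w => (A ∩ X.filter (fun y => w + y ∈ X)).image (fun y => w + y)) ha (by
      intro w hw
      refine ⟨?_, ?_⟩
      · intro z hz
        obtain ⟨y, hy, rfl⟩ := mem_image.1 hz
        exact (mem_filter.1 (mem_inter.1 hy).2).2
      · rw [card_image_of_injective _ (add_right_injective w)]
        exact hAS w hw) hPc h2
  refine ⟨A ∪ B, union_subset hAX hBX, (card_union_le _ _).trans (by omega), ?_⟩
  intro w hw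
  obtain ⟨b, hb⟩ := hBS w hw
  rw [mem_inter, mem_image] at hb
  obtain ⟨hbB, y, hy, rfl⟩ := hb
  refine mem_add.2 ⟨w + y, mem_union_right _ hbB, y, mem_union_left _ (mem_inter.1 hy).1, ?_⟩
  rw [add_assoc, ZModModule.add_self, add_zero]

/-- Enlarge Y₀ ∪ Y₁ greedily. An x outside it that is not a d-fold sum neighbour adds more than a -
d ≥ 3d new sums, so Y₁ stays small when X + X is small. -/
theorem exists_subset_sumNeighbours (X : Finset G) {d a : ℕ} (hd : 0 < d) (ha : 4 * d ≤ a)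
    (hX : a ≤ #X) : ∃ Y₀ ⊆ X, ∃ Y₁ ⊆ X, #Y₀ = a ∧ 3 * d * #Y₁ ≤ #(X + X) ∧
      X ⊆ sumNeighbours d (Y₀ ∪ Y₁) := by
  classical
  obtain ⟨Y₀, hY₀, hcard⟩ := exists_subset_card_eq hX
  obtain ⟨Y₁, hY₁, hmax⟩ := exists_max_image
    ((X \ Y₀).powerset.filter (fun F => 3 * d * #F ≤ #((Y₀ ∪ F) + (Y₀ ∪ F))))
    (fun F => #F) ⟨∅, by simp⟩
  rw [mem_filter, mem_powerset] at hY₁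
  have hsub : Y₀ ∪ Y₁ ⊆ X := union_subset hY₀ (hY₁.1.trans sdiff_subset)
  set Y := Y₀ ∪ Y₁ with hY
  refine ⟨Y₀, hY₀, Y₁, hY₁.1.trans sdiff_subset, hcard,
    hY₁.2.trans (card_le_card (add_subset_add hsub hsub)), ?_⟩
  have hYcard : a ≤ #Y := hcard ▸ card_le_card subset_union_left
  intro x hx
  have hmany : d ≤ #(Y.filter (fun y => x + y ∈ Y + Y)) := by
    by_cases hxY : x ∈ Y
    · rw [filter_true_of_mem fun y hy => add_mem_add hxY hy]
      omega
    have hx0 : x ∉ Y₀ := fun h => hxY (mem_union_left _ h)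
    have hx1 : x ∉ Y₁ := fun h => hxY (mem_union_right _ h)
    by_contra! hcon
    have hsplit := card_filter_add_card_filter_not (s := Y) (fun y => x + y ∈ Y + Y)
    have hins : Y₀ ∪ insert x Y₁ = insert x Y := by rw [union_insert]
    have hle : #(Y + Y) + #(Y.filter (fun y => x + y ∉ Y + Y)) ≤ #(insert x Y + insert x Y) := by
      rw [← card_image_of_injective (Y.filter (fun y => x + y ∉ Y + Y)) (add_right_injective x),
        ← card_union_of_disjoint]
      · apply card_le_card
        apply union_subset (add_subset_add (subset_insert _ _) (subset_insert _ _))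
        intro z hz
        obtain ⟨y, hy, rfl⟩ := mem_image.1 hz
        exact add_mem_add (mem_insert_self _ _) (mem_insert_of_mem (mem_filter.1 hy).1)
      · rw [disjoint_right]
        intro z hz
        obtain ⟨y, hy, rfl⟩ := mem_image.1 hz
        exact (mem_filter.1 hy).2
    have := hmax (insert x Y₁) (by
      rw [mem_filter, mem_powerset, hins, card_insert_of_notMem hx1]
      refine ⟨insert_subset (mem_sdiff.2 ⟨hx, hx0⟩) hY₁.1, ?_⟩
      have h1 := hY₁.2
      rw [mul_add, mul_one]
      omega)
    simp only [card_insert_of_notMem hx1] at this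
    omega
  refine mem_filter.2 ⟨?_, hmany⟩
  obtain ⟨y, hy⟩ := card_pos.1 (lt_of_lt_of_le hd hmany)
  rw [mem_filter] at hy
  refine mem_add.2 ⟨x + y, hy.2, y, hy.1, ?_⟩
  rw [add_assoc, ZModModule.add_self, add_zero]

/-- The translates z + U and z' + U both lie in Q up to h elements. Since Q is smaller than 2|U|,
they share at least τ elements, and each shared element represents z + z' as a sum of two elements
of X. -/
theorem add_mem_of_card_filter_le (X U Q : Finset G) {h τ : ℕ} (hU : U ⊆ X) (hτ : 0 < τ)
    (hQ : ∀ w ∈ X + X, τ ≤ #(X.filter (fun y => w + y ∈ X)) → w ∈ Q)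
    (hcard : #Q + 2 * h + τ ≤ 2 * #U) {z z' : G}
    (hz : #(U.filter (fun y => z + y ∉ Q)) ≤ h) (hz' : #(U.filter (fun y => z' + y ∉ Q)) ≤ h) :
    z + z' ∈ Q := by
  set A := (U.filter (fun y => z + y ∈ Q)).image (fun y => z + y) with hA
  set B := (U.filter (fun y => z' + y ∈ Q)).image (fun y => z' + y) with hB
  have hAc : #A = #(U.filter (fun y => z + y ∈ Q)) :=
    card_image_of_injective _ (add_right_injective z)
  have hBc : #B = #(U.filter (fun y => z' + y ∈ Q)) :=
    card_image_of_injective _ (add_right_injective z')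
  have hs := card_filter_add_card_filter_not (s := U) (fun y => z + y ∈ Q)
  have hs' := card_filter_add_card_filter_not (s := U) (fun y => z' + y ∈ Q)
  have hAB : A ∪ B ⊆ Q := by
    apply union_subset
    · intro u hu
      obtain ⟨y, hy, rfl⟩ := mem_image.1 hu
      exact (mem_filter.1 hy).2
    · intro u hu
      obtain ⟨y, hy, rfl⟩ := mem_image.1 hu
      exact (mem_filter.1 hy).2
  have hinter := card_union_add_card_inter A B
  have hle := card_le_card hAB
  have hr : #(A ∩ B) ≤ #(X.filter (fun y => z + z' + y ∈ X)) := by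
    refine card_le_card_of_injOn (fun u => z + u) ?_ (fun u _ u' _ h => add_right_injective z h)
    intro u hu
    rw [mem_coe, mem_inter] at hu
    obtain ⟨y, hy, rfl⟩ := mem_image.1 hu.1
    obtain ⟨y', hy', hyy⟩ := mem_image.1 hu.2
    simp only [mem_coe, mem_filter, zmod_two_add_add_cancel]
    refine ⟨hU (mem_filter.1 hy).1, ?_⟩
    rw [add_comm z z', add_assoc, ← hyy, zmod_two_add_add_cancel]
    exact hU (mem_filter.1 hy').1
  have hτr : τ ≤ #(X.filter (fun y => z + z' + y ∈ X)) := by omega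
  refine hQ _ ?_ hτr
  obtain ⟨y, hy⟩ := card_pos.1 (lt_of_lt_of_le hτ hτr)
  rw [mem_filter] at hy
  refine mem_add.2 ⟨z + z' + y, hy.2, y, hy.1, ?_⟩
  rw [add_assoc, ZModModule.add_self, add_zero]

/-- The elements `z` with `z + Y ⊆ Q`. -/
def commonTranslates (Q Y : Finset G) : Finset G :=
  (Q + Y).filter (fun z => ∀ y ∈ Y, z + y ∈ Q)

omit [Module (ZMod 2) G] in
theorem commonTranslates_subset (Q Y : Finset G) : commonTranslates Q Y ⊆ Q + Y :=
  filter_subset _ _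

/-- If the popular sums of a set `X` with more than `2 ^ m` elements lie in a set `Q` with
fewer than `2 ^ (m + 1)` elements, then `X` is almost determined by `Q` and a few of its
elements. -/
theorem exists_commonTranslates_approx (X Q : Finset G) {m h τ e h' c : ℕ} (hX : #X = 2 ^ m + 1)
    (hτ : 0 < τ) (hh : 0 < h)
    (hQ : ∀ w ∈ X + X, τ ≤ #(X.filter (fun y => w + y ∈ X)) → w ∈ Q)
    (hcard : #Q + 2 * e + 2 * h + τ ≤ 2 ^ (m + 1) + 2)
    (heh : τ * #(X + X) ≤ e * h) (hQc : #Q < 2 ^ c) (hth : c * #X ≤ h * h') :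
    ∃ Y' ⊆ X, #Y' ≤ h' + 1 ∧
      #(X \ commonTranslates Q Y') ≤ e ∧ #(commonTranslates Q Y' \ X) ≤ e := by
  classical
  -- Sums outside Q are unpopular, so at most τ|X + X| pairs produce them, and all but e elements of
  -- X take part in at most h such pairs.
  set X₁ := X.filter (fun x => #(X.filter (fun y => x + y ∉ Q)) ≤ h) with hX₁
  have hX₁X : X₁ ⊆ X := filter_subset _ _
  have hE : #(X.filter (fun x => ¬ #(X.filter (fun y => x + y ∉ Q)) ≤ h)) ≤ e := by
    have h1 : #(X.filter (fun x => ¬ #(X.filter (fun y => x + y ∉ Q)) ≤ h)) * (h + 1) ≤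
        ∑ x ∈ X, #(X.filter (fun y => x + y ∉ Q)) := by
      rw [← smul_eq_mul, ← sum_const]
      refine (sum_le_sum fun x hx => ?_).trans
        (sum_le_sum_of_subset (filter_subset _ X))
      have := (mem_filter.1 hx).2
      omega
    have h2 : ∑ x ∈ X, #(X.filter (fun y => x + y ∉ Q)) ≤ τ * #(X + X) := by
      rw [← card_sigma]
      calc _ ≤ ∑ w ∈ (X + X).filter (fun w => w ∉ Q), #(X.filter (fun y => w + y ∈ X)) := by
            rw [← card_sigma]
            refine card_le_card_of_injOn (fun p => ⟨p.1 + p.2, p.2⟩) ?_ ?_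
            · rintro ⟨x, y⟩ hp
              simp only [mem_coe, mem_sigma, mem_filter] at hp ⊢
              refine ⟨⟨add_mem_add hp.1 hp.2.1, hp.2.2⟩, hp.2.1, ?_⟩
              rw [add_assoc, ZModModule.add_self, add_zero]
              exact hp.1
            · rintro ⟨x, y⟩ _ ⟨x', y'⟩ _ hpp
              simp only [Sigma.mk.injEq, heq_eq_eq] at hpp ⊢
              obtain ⟨h1, rfl⟩ := hpp
              exact ⟨add_left_injective y h1, rfl⟩
        _ ≤ ∑ w ∈ (X + X).filter (fun w => w ∉ Q), τ := by
            refine sum_le_sum fun w hw => ?_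
            rw [mem_filter] at hw
            by_contra! hc
            exact hw.2 (hQ w hw.1 hc.le)
        _ ≤ τ * #(X + X) := by
            rw [sum_const, smul_eq_mul, mul_comm]
            exact Nat.mul_le_mul_left _ (card_filter_le _ _)
    by_contra hc
    rw [not_le] at hc
    have h3 := Nat.mul_le_mul_right (h + 1) hc
    nlinarith
  have hX₁c : 2 ^ m + 1 ≤ #X₁ + e := by
    have : #X₁ + #(X.filter (fun x => ¬ #(X.filter (fun y => x + y ∉ Q)) ≤ h)) = #X :=
      card_filter_add_card_filter_not _
    omega
  obtain ⟨y₀, hy₀⟩ : X₁.Nonempty := card_pos.1 (by omega)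
  have hX₁Q : ∀ x ∈ X₁, ∀ y ∈ X₁, x + y ∈ Q := fun x hx y hy =>
    add_mem_of_card_filter_le X X Q Subset.rfl hτ hQ (h := h) (by rw [pow_succ] at hcard; omega)
      (mem_filter.1 hx).2 (mem_filter.1 hy).2
  -- Including y₀ in Y' confines the candidates z to Q + y₀, so only |Q| sets need hitting. The set
  -- H excludes every candidate with more than h failures.
  obtain ⟨H, hHX, hHc, hhit⟩ := exists_hitting_set X₁
    ((Q.image (fun z => z + y₀)).filter (fun z => h < #(X₁.filter (fun y => z + y ∉ Q))))
    (fun z => X₁.filter (fun y => z + y ∉ Q)) hh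
    (fun z hz => ⟨filter_subset _ _, (mem_filter.1 hz).2.le⟩)
    (lt_of_le_of_lt ((card_filter_le _ _).trans card_image_le) hQc)
    ((Nat.mul_le_mul_left _ (card_le_card hX₁X)).trans hth)
  have hY'X : insert y₀ H ⊆ X₁ := insert_subset hy₀ hHX
  set Z := commonTranslates Q (insert y₀ H) with hZ
  have hZgood : ∀ z ∈ Z, #(X₁.filter (fun y => z + y ∉ Q)) ≤ h := by
    intro z hz
    have hz2 := (mem_filter.1 hz).2
    by_contra! hc
    obtain ⟨y, hy⟩ := hhit z (mem_filter.2 ⟨mem_image.2 ⟨z + y₀, hz2 y₀ (mem_insert_self _ _), by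
      rw [add_assoc, ZModModule.add_self, add_zero]⟩, hc⟩)
    rw [mem_inter, mem_filter] at hy
    exact hy.2.2 (hz2 y (mem_insert_of_mem hy.1))
  have hZZ : Z + Z ⊆ Q := by
    intro w hw
    obtain ⟨z, hz, z', hz', rfl⟩ := mem_add.1 hw
    exact add_mem_of_card_filter_le X X₁ Q hX₁X hτ hQ (h := h)
      (by rw [pow_succ] at hcard; omega) (hZgood z hz) (hZgood z' hz')
  -- Otherwise Z + Z ⊆ Q would have at least 2^(m+1) elements, more than Q has. This caps the excess
  -- of Z over X₁.
  have hZc : #Z ≤ 2 ^ m := by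
    by_contra! hc
    have h1 := two_pow_succ_le_card_add_self hc
    have h2 := card_le_card hZZ
    omega
  have hXZ : X₁ ⊆ Z := by
    intro x hx
    refine mem_filter.2 ⟨?_, fun y hy => hX₁Q x hx y (hY'X hy)⟩
    refine mem_add.2 ⟨x + y₀, hX₁Q x hx y₀ hy₀, y₀, mem_insert_self _ _, ?_⟩
    rw [add_assoc, ZModModule.add_self, add_zero]
  refine ⟨insert y₀ H, hY'X.trans hX₁X, (card_insert_le _ _).trans (by omega), ?_, ?_⟩
  · have h1 := card_le_card (sdiff_subset_sdiff (Subset.refl X) hXZ)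
    rw [← hZ]
    have h2 := card_sdiff_of_subset hX₁X
    omega
  · rw [← hZ]
    have h1 : #(Z \ X) ≤ #(Z \ X₁) := card_le_card (sdiff_subset_sdiff (Subset.refl Z) hX₁X)
    have h2 := card_sdiff_of_subset hXZ
    omega

end Structure

/-! ### Counting the families used in the union bound. -/

section Counting

open Finset
open scoped Pointwise

/-- The subsets of `U` with at most `p` elements. -/
def smallSubsets {α : Type*} [DecidableEq α] (U : Finset α) (p : ℕ) : Finset (Finset α) :=
  U.powerset.filter (fun S => #S ≤ p)

theorem mem_smallSubsets {α : Type*} [DecidableEq α] {U S : Finset α} {p : ℕ} :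
    S ∈ smallSubsets U p ↔ S ⊆ U ∧ #S ≤ p := by
  rw [smallSubsets, mem_filter, mem_powerset]

theorem card_smallSubsets_le {α : Type*} [DecidableEq α] (U : Finset α) (p : ℕ) :
    #(smallSubsets U p) ≤ (#U + 1) ^ p := by
  induction p with
  | zero =>
    have : smallSubsets U 0 ⊆ {∅} := by
      intro S hS
      simpa using (mem_smallSubsets.1 hS).2
    simpa using card_le_card this
  | succ p ih =>
    have : smallSubsets U (p + 1) ⊆
        smallSubsets U p ∪ (U ×ˢ smallSubsets U p).image (fun x => insert x.1 x.2) := by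
      intro S hS
      rw [mem_smallSubsets] at hS
      rcases S.eq_empty_or_nonempty with rfl | ⟨x, hx⟩
      · exact mem_union_left _ (mem_smallSubsets.2 (by simp))
      · refine mem_union_right _ (mem_image.2 ⟨(x, S.erase x), mem_product.2 ⟨hS.1 hx,
          mem_smallSubsets.2 ⟨(erase_subset _ _).trans hS.1, ?_⟩⟩, insert_erase hx⟩)
        rw [card_erase_of_mem hx]
        omega
    calc #(smallSubsets U (p + 1)) ≤ _ := card_le_card this
      _ ≤ #(smallSubsets U p) + #U * #(smallSubsets U p) :=
        (card_union_le _ _).trans (Nat.add_le_add_left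
          (card_image_le.trans (card_product _ _).le) _)
      _ = (#U + 1) * #(smallSubsets U p) := by ring
      _ ≤ (#U + 1) * (#U + 1) ^ p := Nat.mul_le_mul_left _ ih
      _ = _ := (pow_succ' _ _).symm

variable {G : Type*} [AddCommGroup G] [Module (ZMod 2) G] [DecidableEq G] [Fintype G]

open Classical in
/-- The span of a finite set as a finite set. -/
noncomputable def spanFinset {G : Type*} [AddCommGroup G] [Module (ZMod 2) G] [Fintype G]
    (B : Finset G) : Finset G :=
  univ.filter (fun x => x ∈ Submodule.span (ZMod 2) (B : Set G))

omit [DecidableEq G] in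
theorem mem_spanFinset {B : Finset G} {x : G} :
    x ∈ spanFinset B ↔ x ∈ Submodule.span (ZMod 2) (B : Set G) := by
  simp [spanFinset]

omit [DecidableEq G] in
theorem card_spanFinset_le (B : Finset G) : #(spanFinset B) ≤ 2 ^ #B := by
  classical
  have h : #(spanFinset B) = Nat.card (Submodule.span (ZMod 2) (B : Set G)) := by
    rw [Nat.card_eq_fintype_card, Fintype.card_subtype]
    congr 1
  rw [h, Module.natCard_eq_pow_finrank (K := ZMod 2), Nat.card_zmod]
  exact Nat.pow_le_pow_right (by norm_num) (finrank_span_finset_le_card B)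

omit [DecidableEq G] in
theorem exists_subset_spanFinset (X : Finset G) {r : ℕ}
    (hr : Module.finrank (ZMod 2) (Submodule.span (ZMod 2) (X : Set G)) ≤ r) :
    ∃ B : Finset G, #B ≤ r ∧ X ⊆ spanFinset B := by
  obtain ⟨B, -, hB, hspan, -⟩ :=
    Submodule.exists_finset_span_eq_linearIndepOn (ZMod 2) (X : Set G)
  refine ⟨B, hB ▸ hr, fun x hx => ?_⟩
  rw [mem_spanFinset, hspan]
  exact Submodule.subset_span hx

/-- The subsets of size at most `y` of subspaces of dimension at most `r`. -/
noncomputable def lowRankSubsets (G : Type*) [AddCommGroup G] [Module (ZMod 2) G] [DecidableEq G]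
    [Fintype G] (r y : ℕ) : Finset (Finset G) :=
  (smallSubsets univ r).biUnion fun B => smallSubsets (spanFinset B) y

theorem mem_lowRankSubsets {X Y : Finset G} {r y : ℕ}
    (hr : Module.finrank (ZMod 2) (Submodule.span (ZMod 2) (X : Set G)) ≤ r) (hYX : Y ⊆ X)
    (hY : #Y ≤ y) : Y ∈ lowRankSubsets G r y := by
  obtain ⟨B, hB, hXB⟩ := exists_subset_spanFinset X hr
  exact mem_biUnion.2 ⟨B, mem_smallSubsets.2 ⟨subset_univ _, hB⟩,
    mem_smallSubsets.2 ⟨hYX.trans hXB, hY⟩⟩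

theorem card_smallSubsets_spanFinset_le {B : Finset G} {r : ℕ} (hB : #B ≤ r) (y : ℕ) :
    #(smallSubsets (spanFinset B) y) ≤ 2 ^ ((r + 1) * y) := by
  refine (card_smallSubsets_le _ _).trans ?_
  rw [pow_mul]
  apply Nat.pow_le_pow_left
  have h1 : #(spanFinset B) ≤ 2 ^ r :=
    (card_spanFinset_le B).trans (Nat.pow_le_pow_right (by norm_num) hB)
  have h2 := Nat.one_le_two_pow (n := r)
  rw [pow_succ]
  omega

theorem card_smallSubsets_univ_le {α : Type*} [DecidableEq α] [Fintype α] {n : ℕ}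
    (hG : Fintype.card α = 2 ^ n) (p : ℕ) :
    #(smallSubsets (univ : Finset α) p) ≤ 2 ^ ((n + 1) * p) := by
  refine (card_smallSubsets_le _ _).trans ?_
  rw [pow_mul, card_univ, hG]
  apply Nat.pow_le_pow_left
  have h2 := Nat.one_le_two_pow (n := n)
  rw [pow_succ]
  omega

theorem card_lowRankSubsets_le {n : ℕ} (hG : Fintype.card G = 2 ^ n) (r y : ℕ) :
    #(lowRankSubsets G r y) ≤ 2 ^ ((n + 1) * r + (r + 1) * y) := by
  refine (card_biUnion_le_card_mul _ _ (2 ^ ((r + 1) * y)) fun B hB =>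
    card_smallSubsets_spanFinset_le (mem_smallSubsets.1 hB).2 _).trans ?_
  rw [pow_add]
  exact Nat.mul_le_mul_right _ (card_smallSubsets_univ_le hG r)

/-- The sets of the form `(Z \ D) ∪ E` where `Z` is the set of common translates determined by `Y`
and `Y'`, and `Y`, `Y'`, `D`, `E` are small subsets of the same subspace of small dimension. -/
noncomputable def nearTranslateSets (G : Type*) [AddCommGroup G] [Module (ZMod 2) G]
    [DecidableEq G] [Fintype G] (r y : ℕ) : Finset (Finset G) :=
  (smallSubsets univ r).biUnion fun B =>
    (smallSubsets (spanFinset B) y ×ˢ smallSubsets (spanFinset B) y ×ˢ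
      smallSubsets (spanFinset B) y ×ˢ smallSubsets (spanFinset B) y).image
      fun q => (commonTranslates (q.1 + q.1) q.2.1 \ q.2.2.1) ∪ q.2.2.2

/-- The common translates lie in Y + Y + Y', hence in the span of X. The corrections can therefore
be named inside that subspace, at about r rather than n bits per element. -/
theorem mem_nearTranslateSets {X Y Y' : Finset G} {r y : ℕ}
    (hr : Module.finrank (ZMod 2) (Submodule.span (ZMod 2) (X : Set G)) ≤ r)
    (hY : Y ⊆ X) (hYc : #Y ≤ y) (hY' : Y' ⊆ X) (hYc' : #Y' ≤ y)
    (h1 : #(X \ commonTranslates (Y + Y) Y') ≤ y) (h2 : #(commonTranslates (Y + Y) Y' \ X) ≤ y) :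
    X ∈ nearTranslateSets G r y := by
  obtain ⟨B, hB, hXB⟩ := exists_subset_spanFinset X hr
  refine mem_biUnion.2 ⟨B, mem_smallSubsets.2 ⟨subset_univ _, hB⟩, mem_image.2
    ⟨(Y, Y', commonTranslates (Y + Y) Y' \ X, X \ commonTranslates (Y + Y) Y'), ?_, ?_⟩⟩
  · simp only [mem_product, mem_smallSubsets]
    refine ⟨⟨hY.trans hXB, hYc⟩, ⟨hY'.trans hXB, hYc'⟩, ⟨?_, h2⟩, ⟨sdiff_subset.trans hXB, h1⟩⟩
    intro z hz
    obtain ⟨w, hw, y', hy', rfl⟩ := mem_add.1 (commonTranslates_subset _ _ (Finset.mem_sdiff.1 hz).1)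
    obtain ⟨u, hu, v, hv, rfl⟩ := mem_add.1 hw
    have hmem : ∀ x ∈ X, x ∈ Submodule.span (ZMod 2) (B : Set G) :=
      fun x hx => mem_spanFinset.1 (hXB hx)
    exact mem_spanFinset.2 (Submodule.add_mem _ (Submodule.add_mem _ (hmem _ (hY hu))
      (hmem _ (hY hv))) (hmem _ (hY' hy')))
  · ext x
    simp only [mem_union, Finset.mem_sdiff]
    tauto

theorem card_nearTranslateSets_le {n : ℕ} (hG : Fintype.card G = 2 ^ n) (r y : ℕ) :
    #(nearTranslateSets G r y) ≤ 2 ^ ((n + 1) * r + (r + 1) * y * 4) := by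
  refine (card_biUnion_le_card_mul _ _ (2 ^ ((r + 1) * y * 4)) fun B hB => ?_).trans ?_
  · refine card_image_le.trans ?_
    have h := card_smallSubsets_spanFinset_le (mem_smallSubsets.1 hB).2 y
    rw [card_product, card_product, card_product, pow_mul]
    calc _ ≤ 2 ^ ((r + 1) * y) * (2 ^ ((r + 1) * y) * (2 ^ ((r + 1) * y) * 2 ^ ((r + 1) * y))) := by
          gcongr
      _ = _ := by ring
  · rw [pow_add]
    exact Nat.mul_le_mul_right _ (card_smallSubsets_univ_le hG r)

/-- The `k`-element sets that are contained in the set of `d`-fold sum neighbours of the union of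
an `a`-element set of small rank and a set of at most `p` elements. -/
noncomputable def sumNeighbourSubsets (G : Type*) [AddCommGroup G] [Module (ZMod 2) G]
    [DecidableEq G] [Fintype G] (r a p d k σ : ℕ) : Finset (Finset G) :=
  (lowRankSubsets G r a ×ˢ smallSubsets univ p).biUnion fun Y =>
    if #(Y.1 ∪ Y.2) * #((Y.1 ∪ Y.2) + (Y.1 ∪ Y.2)) ≤ (a + p) * σ then
      powersetCard k (sumNeighbours d (Y.1 ∪ Y.2)) else ∅

theorem mem_sumNeighbourSubsets {X : Finset G} {r a p d : ℕ}
    (hr : Module.finrank (ZMod 2) (Submodule.span (ZMod 2) (X : Set G)) ≤ r)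
    (hd : 0 < d) (ha : 4 * d ≤ a) (hX : a ≤ #X) (hp : #(X + X) < 3 * d * (p + 1)) :
    X ∈ sumNeighbourSubsets G r a p d (#X) #(X + X) := by
  obtain ⟨Y₀, h0, Y₁, h1, hc0, hc1, hX⟩ := exists_subset_sumNeighbours X hd ha hX
  have hp1 : #Y₁ ≤ p := by
    have := Nat.lt_of_mul_lt_mul_left (hc1.trans_lt hp)
    omega
  refine mem_biUnion.2 ⟨(Y₀, Y₁), mem_product.2 ⟨mem_lowRankSubsets hr h0 hc0.le,
    mem_smallSubsets.2 ⟨subset_univ _, hp1⟩⟩, ?_⟩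
  rw [if_pos, mem_powersetCard]
  · exact ⟨hX, rfl⟩
  · have := union_subset h0 h1
    exact Nat.mul_le_mul ((card_union_le _ _).trans (Nat.add_le_add hc0.le hp1))
      (card_le_card (add_subset_add this this))

/-- The exponent pays for a subspace, a points inside it and p arbitrary points;
`mul_card_sumNeighbours_le` bounds by M the ground set from which the k elements are then chosen. -/
theorem card_sumNeighbourSubsets_le {n : ℕ} (hG : Fintype.card G = 2 ^ n) (r a p k σ M : ℕ)
    {d : ℕ} (hd : 0 < d) (hM : (a + p) * σ ≤ d * M) :
    #(sumNeighbourSubsets G r a p d k σ) ≤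
      2 ^ ((n + 1) * r + (r + 1) * a + (n + 1) * p) * M.choose k := by
  refine (card_biUnion_le_card_mul _ _ (M.choose k) fun Y _ => ?_).trans ?_
  · split_ifs with h
    · rw [card_powersetCard]
      apply Nat.choose_le_choose
      exact Nat.le_of_mul_le_mul_left ((mul_card_sumNeighbours_le _ _).trans (h.trans hM)) hd
    · simp
  · apply Nat.mul_le_mul_right
    rw [card_product, pow_add]
    exact Nat.mul_le_mul (card_lowRankSubsets_le hG r a) (card_smallSubsets_univ_le hG p)

/-- The standard bound (eM/k)^k, with e replaced by 3. -/
theorem choose_le_two_pow {M k b : ℕ} (hk : 0 < k) (h : 3 * M ≤ 2 ^ b * k) :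
    M.choose k ≤ 2 ^ (b * k) := by
  have hk' : (0 : ℝ) < k := by exact_mod_cast hk
  have h1 : (M.choose k : ℝ) ≤ (M : ℝ) ^ k / k.factorial := Nat.choose_le_pow_div k M
  have h2 : (k : ℝ) ^ k / k.factorial ≤ 3 ^ k := by
    refine (Real.pow_div_factorial_le_exp k hk'.le k).trans ?_
    have : Real.exp (k : ℝ) = Real.exp 1 ^ k := by rw [← Real.exp_nat_mul, mul_one]
    rw [this]
    exact pow_le_pow_left₀ (Real.exp_pos 1).le (by linarith [Real.exp_one_lt_d9]) _
  have h3 : (M : ℝ) * 3 / k ≤ 2 ^ b := by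
    rw [div_le_iff₀ hk']
    have : ((3 * M : ℕ) : ℝ) ≤ ((2 ^ b * k : ℕ) : ℝ) := by exact_mod_cast h
    push_cast at this
    linarith
  have h4 : (M.choose k : ℝ) ≤ (2 : ℝ) ^ (b * k) := by
    calc (M.choose k : ℝ) ≤ (M : ℝ) ^ k / k.factorial := h1
      _ = ((M : ℝ) / k) ^ k * ((k : ℝ) ^ k / k.factorial) := by
        rw [div_pow]; field_simp
      _ ≤ ((M : ℝ) / k) ^ k * 3 ^ k := by gcongr
      _ = ((M : ℝ) * 3 / k) ^ k := by rw [← mul_pow]; ring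
      _ ≤ (2 ^ b) ^ k := by gcongr
      _ = _ := by rw [pow_mul]
  exact_mod_cast h4

end Counting

/-! ### Avoidance probabilities and the union bound. -/

section Probability

open Finset

variable {n : ℕ}

instance : IsProbabilityMeasure (randomSubset n) := by
  unfold randomSubset
  infer_instance

theorem randomSubset_real_disjoint (C : Finset (Fin n → ZMod 2)) :
    (randomSubset n).real {A | ∀ w ∈ C, w ∉ A} = (1 / 2) ^ #C := by
  unfold randomSubset
  rw [measureReal_def, setBernoulli_apply']
  have : ((fun p : (Fin n → ZMod 2) → Prop => {i | p i}) ⁻¹'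
      {A : Set (Fin n → ZMod 2) | ∀ w ∈ C, w ∉ A}) =
      Set.pi (C : Set (Fin n → ZMod 2)) (fun _ => {False}) := by
    ext p
    simp [Set.mem_pi]
  rw [this, Measure.infinitePi_pi _ (fun i _ => MeasurableSet.of_discrete)]
  have hterm : ∀ i ∈ C, (unitInterval.toNNReal (⟨1 / 2, by norm_num, by norm_num⟩ : unitInterval) •
      Measure.dirac (i ∈ (Set.univ : Set (Fin n → ZMod 2))) +
      unitInterval.toNNReal (unitInterval.symm ⟨1 / 2, by norm_num, by norm_num⟩) •
        Measure.dirac False) {False} = ENNReal.ofReal (1 / 2) := by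
    intro i _
    have h : unitInterval.toNNReal (unitInterval.symm ⟨1 / 2, by norm_num, by norm_num⟩) =
        (1 / 2 : NNReal) := by
      ext
      simp
      norm_num
    rw [h]
    simp
  rw [prod_congr rfl hterm, prod_const, ENNReal.toReal_pow, ENNReal.toReal_ofReal (by norm_num)]

/-- Adjacency ignores the sum 0, so at most one factor 1/2 is lost; this accounts for the constant
2. -/
theorem randomSubset_real_avoid_le (C : Finset (Fin n → ZMod 2)) :
    (randomSubset n).real {A | ∀ w ∈ C, w ≠ 0 → w ∉ A} ≤ 2 * (1 / 2) ^ #C := by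
  have h1 : {A : Set (Fin n → ZMod 2) | ∀ w ∈ C, w ≠ 0 → w ∉ A} =
      {A | ∀ w ∈ C.erase 0, w ∉ A} := by
    ext A
    simp only [Set.mem_ofPred_eq, mem_erase]
    exact ⟨fun h w hw => h w hw.2 hw.1, fun h w hw hw0 => h w ⟨hw0, hw⟩⟩
  rw [h1, randomSubset_real_disjoint]
  have h2 : #C ≤ #(C.erase 0) + 1 := by
    have := pred_card_le_card_erase (s := C) (a := (0 : Fin n → ZMod 2))
    omega
  calc ((1 : ℝ) / 2) ^ #(C.erase 0) = 2 * (1 / 2) ^ (#(C.erase 0) + 1) := by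
        rw [pow_succ]; ring
    _ ≤ 2 * (1 / 2) ^ #C := by
        gcongr ?_ * ?_
        exact pow_le_pow_of_le_one (by norm_num) (by norm_num) h2

theorem randomSubset_real_exists_avoid_le {ι : Type*} (s : Finset ι)
    (C : ι → Finset (Fin n → ZMod 2)) {c N : ℕ} (hc : ∀ i ∈ s, c ≤ #(C i)) (hN : #s ≤ N) :
    (randomSubset n).real {A | ∃ i ∈ s, ∀ w ∈ C i, w ≠ 0 → w ∉ A} ≤ N * (2 * (1 / 2) ^ c) := by
  have h1 : {A : Set (Fin n → ZMod 2) | ∃ i ∈ s, ∀ w ∈ C i, w ≠ 0 → w ∉ A} =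
      ⋃ i ∈ s, {A | ∀ w ∈ C i, w ≠ 0 → w ∉ A} := by
    ext A
    simp
  rw [h1]
  calc _ ≤ ∑ i ∈ s, (randomSubset n).real {A | ∀ w ∈ C i, w ≠ 0 → w ∉ A} :=
        measureReal_biUnion_finset_le _ _
    _ ≤ ∑ i ∈ s, 2 * (1 / 2) ^ c := by
        refine sum_le_sum fun i hi => (randomSubset_real_avoid_le _).trans ?_
        gcongr ?_ * ?_
        exact pow_le_pow_of_le_one (by norm_num) (by norm_num) (hc i hi)
    _ = #s * (2 * (1 / 2) ^ c) := by rw [sum_const, nsmul_eq_mul]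
    _ ≤ _ := by gcongr

end Probability

/-! ### Choice of parameters and comparison of exponents. -/

section Numerics

/-- With D = 8 the growth factor is 14/8, whose square exceeds 2; hence R is at most twice log k. -/
theorem rank_excess_le {m k R : ℕ} (hk : k ≤ 2 ^ (m + 1))
    (h : (2 * 8 - 2) ^ R ≤ k * 8 ^ R) : R ≤ 2 * m + 2 := by
  have h1 : 2 ^ R * 64 ^ R ≤ k ^ 2 * 64 ^ R := by
    calc 2 ^ R * 64 ^ R = 128 ^ R := by rw [← mul_pow]; norm_num
      _ ≤ 196 ^ R := Nat.pow_le_pow_left (by norm_num) _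
      _ = ((2 * 8 - 2) ^ R) ^ 2 := by rw [← pow_mul, mul_comm R 2, pow_mul]; norm_num
      _ ≤ (k * 8 ^ R) ^ 2 := Nat.pow_le_pow_left h 2
      _ = k ^ 2 * 64 ^ R := by rw [mul_pow, ← pow_mul, mul_comm R 2, pow_mul]; norm_num
  have h2 : 2 ^ R ≤ k ^ 2 := Nat.le_of_mul_le_mul_right h1 (by positivity)
  have h3 : 2 ^ R ≤ 2 ^ (2 * m + 2) := by
    refine h2.trans ((Nat.pow_le_pow_left hk 2).trans (le_of_eq ?_))
    rw [← pow_mul]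
    congr 1
    ring
  exact (Nat.pow_le_pow_iff_right (by norm_num)).1 h3

/-- With D = q ≈ √m the growth factor is 2(1 - 1/q), so the rank exceeds m by only O(m/q) = O(q).
This balances the term K * D of the rank bound, which is also O(q) for bounded K. -/
theorem rank_excess_le_of_sqrt {m k q R : ℕ} (hq : 30 ≤ q) (hm : m < (q + 1) * (q + 1))
    (hk : k ≤ 2 ^ (m + 1)) (h : (2 * q - 2) ^ R ≤ k * q ^ R) : R ≤ m + 6 * q + 30 := by
  have hq' : (30 : ℝ) ≤ q := by exact_mod_cast hq
  have hm' : (m : ℝ) + 1 ≤ (q + 1) * (q + 1) := by exact_mod_cast hm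
  have hqpos : (0 : ℝ) < q := by linarith
  have hcast : ((2 * q - 2 : ℕ) : ℝ) = 2 * q - 2 := by
    rw [Nat.cast_sub (by omega)]; push_cast; ring
  have h1 : ((2 : ℝ) * (1 - 1 / q)) ^ R ≤ 2 ^ (m + 1) := by
    have h2 : ((2 * q - 2 : ℕ) : ℝ) ^ R ≤ k * q ^ R := by exact_mod_cast h
    have h3 : (k : ℝ) ≤ 2 ^ (m + 1) := by exact_mod_cast hk
    have h4 : (2 : ℝ) * (1 - 1 / q) = (2 * q - 2) / q := by field_simp
    rw [h4, div_pow, div_le_iff₀ (by positivity), ← hcast]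
    exact h2.trans (by gcongr)
  have hx : (0 : ℝ) < 1 - 1 / q := by
    rw [sub_pos, div_lt_one hqpos]; linarith
  have h5 := Real.log_le_log (by positivity) h1
  rw [Real.log_pow, Real.log_pow, Real.log_mul (by norm_num) hx.ne'] at h5
  have h6 : -(1 / ((q : ℝ) - 1)) ≤ Real.log (1 - 1 / q) := by
    have := Real.one_sub_inv_le_log_of_pos hx
    have h7 : 1 - (1 - 1 / (q : ℝ))⁻¹ = -(1 / ((q : ℝ) - 1)) := by
      have : (q : ℝ) - 1 ≠ 0 := by linarith
      field_simp
      ring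
    linarith
  have hl := Real.log_two_gt_d9
  have hl' := Real.log_two_lt_d9
  by_contra! hR
  have hR' : (m : ℝ) + 6 * q + 30 + 1 ≤ R := by exact_mod_cast hR
  have h8 : (R : ℝ) * (Real.log 2 - 1 / ((q : ℝ) - 1)) ≤ (m + 1) * Real.log 2 := by
    refine le_trans (mul_le_mul_of_nonneg_left ?_ (Nat.cast_nonneg R)) (by exact_mod_cast h5)
    linarith
  have h9 : (1 : ℝ) / (q - 1) ≤ 1 / 29 := by
    apply one_div_le_one_div_of_le <;> linarith
  have h10 : ((m : ℝ) + 6 * q + 31) * (Real.log 2 - 1 / ((q : ℝ) - 1)) ≤ (m + 1) * Real.log 2 := by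
    refine le_trans ?_ h8
    gcongr
    · linarith
    · linarith
  have h11 : ((m : ℝ) + 6 * q + 31) * (1 / ((q : ℝ) - 1)) ≤ 2 * q := by
    rw [mul_one_div, div_le_iff₀ (by linarith)]
    nlinarith
  nlinarith

theorem three_mul_le_two_pow {κ : ℕ} (h : 1024 ≤ κ) :
    3 * ((κ + 5) * (κ + 1)) ≤ 2 ^ (κ / 8) := by
  have hb : ∀ b : ℕ, 128 ≤ b → 3 * ((8 * b + 13) * (8 * b + 9)) ≤ 2 ^ b := by
    intro b hb
    induction b, hb using Nat.le_induction with
    | base => norm_num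
    | succ b hb ih => rw [pow_succ]; nlinarith
  refine le_trans ?_ (hb (κ / 8) (by omega))
  apply Nat.mul_le_mul_left
  apply Nat.mul_le_mul <;> omega

/-- The main costs are n * p ≤ σ/3 for the free points and κ/8 * k ≤ σ/8 for the binomial
coefficient; the rest is small because nm ≤ 2k and κ and m are large. -/
theorem large_exponent_le {n m k κ σ p : ℕ} (hnm : n * m ≤ 2 * k) (hm : 100000 ≤ m)
    (hn : m ≤ n) (hκ : κ * k ≤ σ) (hσ : 1024 * k ≤ σ) (hp : 3 * n * p ≤ σ) :
    8 * ((n + 1) * (10 * (κ + 1) + 2 * m + 2) + (10 * (κ + 1) + 2 * m + 2 + 1) * (4 * n) +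
      (n + 1) * p + κ / 8 * k) ≤ 7 * σ := by
  have h1 : 100000 * (n * κ) ≤ 2 * σ := by
    calc 100000 * (n * κ) ≤ m * (n * κ) := Nat.mul_le_mul_right _ hm
      _ = n * m * κ := by ring
      _ ≤ 2 * k * κ := Nat.mul_le_mul_right _ hnm
      _ = 2 * (κ * k) := by ring
      _ ≤ 2 * σ := Nat.mul_le_mul_left _ hκ
  have h2 : 100000 * n ≤ 2 * k := by
    calc 100000 * n ≤ m * n := Nat.mul_le_mul_right _ hm
      _ = n * m := by ring
      _ ≤ _ := hnm
  have h3 : κ ≤ n * κ := Nat.le_mul_of_pos_left _ (by omega)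
  have h4 : 100000 * p ≤ n * p := Nat.mul_le_mul_right _ (by omega)
  have h5 : 8 * (κ / 8 * k) ≤ σ := by
    calc 8 * (κ / 8 * k) = (8 * (κ / 8)) * k := by ring
      _ ≤ κ * k := Nat.mul_le_mul_right _ (Nat.mul_div_le _ _)
      _ ≤ σ := hκ
  have h6 : 3 * (n * p) ≤ σ := by rw [← mul_assoc]; exact hp
  have h7 : (n + 1) * (10 * (κ + 1) + 2 * m + 2) + (10 * (κ + 1) + 2 * m + 2 + 1) * (4 * n) +
      (n + 1) * p + κ / 8 * k = 50 * (n * κ) + 10 * (n * m) + 64 * n + 10 * κ + 2 * m + 12 +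
        n * p + p + κ / 8 * k := by ring
  rw [h7]
  omega

theorem small_parameters {n m q : ℕ} (hm : 10000 ≤ m) (hq : 6 ≤ q) (hn : 2 ^ m ≤ n * m)
    (hpow : m ^ 40 ≤ 2 ^ m) :
    ∃ t a h₁ h₂ e h' : ℕ, 0 < t ∧ 0 < a ∧ (m + 12) * (2 ^ m + 1) ≤ t * h₁ ∧
      (m + 12) * (2 ^ m + 1) ≤ a * h₂ ∧ a * h₁ + h₂ ≤ n / m ^ 2 ∧ e ≤ n / m ^ 2 ∧
      h' + 1 ≤ n / m ^ 2 ∧ (m + 12) * (2 ^ m + 1) ≤ n * h' ∧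
      (t + a * h₁) * (1024 * (2 ^ m + 1)) ≤ e * n ∧ 2 * e + 2 * n + (t + a * h₁) ≤ n * q + 2 := by
  have hmpos : 0 < m := by omega
  have hp : ∀ i, 0 < m ^ i := fun i => Nat.pow_pos hmpos
  have hn39 : m ^ 39 ≤ n := by
    refine Nat.le_of_mul_le_mul_right ?_ hmpos
    calc m ^ 39 * m = m ^ 40 := (pow_succ _ _).symm
      _ ≤ _ := hpow.trans hn
  have hlow : ∀ i, i ≤ 39 → m ^ i ≤ n := fun i hi =>
    (Nat.pow_le_pow_right hmpos hi).trans hn39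
  have hdiv : ∀ i, i ≤ 38 → n ≤ 2 * (n / m ^ i * m ^ i) := by
    intro i hi
    have h1 := Nat.lt_div_mul_add (a := n) (hp i)
    have h2 := hlow (i + 1) (by omega)
    rw [pow_succ] at h2
    have h3 : m ^ i * 10000 ≤ m ^ i * m := Nat.mul_le_mul_left _ hm
    omega
  have hk : 2 ^ m + 1 ≤ 2 * (n * m) := by
    have := Nat.one_le_two_pow (n := m)
    omega
  have hck : (m + 12) * (2 ^ m + 1) ≤ 4 * (n * m ^ 2) := by
    calc (m + 12) * (2 ^ m + 1) ≤ (2 * m) * (2 * (n * m)) := Nat.mul_le_mul (by omega) hk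
      _ = _ := by ring
  set a := 2 ^ (m / 2) with ha
  have haa : a * a ≤ 2 ^ m := by
    rw [ha, ← pow_add]
    exact Nat.pow_le_pow_right (by norm_num) (by omega)
  have haa' : 2 ^ m ≤ 2 * (a * a) := by
    rw [ha, ← pow_add, ← pow_succ']
    exact Nat.pow_le_pow_right (by norm_num) (by omega)
  have hapos : 0 < a := by positivity
  have ham : a * m ^ 18 ≤ n := by
    have h1 : m ^ 20 ≤ 2 * a := by
      by_contra! hc
      have h2 : (2 * a) * (2 * a) < m ^ 20 * m ^ 20 := Nat.mul_lt_mul'' hc hc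
      rw [← pow_add] at h2
      have h3 : m ^ (20 + 20) ≤ 2 * (a * a) := hpow.trans haa'
      nlinarith
    have h4 : m * m * (a * m ^ 18) ≤ m * m * n := by
      calc m * m * (a * m ^ 18) = a * m ^ 20 := by ring
        _ ≤ a * (2 * a) := Nat.mul_le_mul_left _ h1
        _ = 2 * (a * a) := by ring
        _ ≤ 2 * (n * m) := Nat.mul_le_mul_left _ (haa.trans hn)
        _ ≤ m * (n * m) := Nat.mul_le_mul_right _ (by omega)
        _ = m * m * n := by ring
    exact Nat.le_of_mul_le_mul_left h4 (by positivity)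
  have hami : ∀ i, i ≤ 18 → a * m ^ i ≤ n := fun i hi =>
    (Nat.mul_le_mul_left _ (Nat.pow_le_pow_right hmpos hi)).trans ham
  have hah1 : a * m ^ 8 ≤ n / m ^ 5 := by
    rw [Nat.le_div_iff_mul_le (hp 5), mul_assoc, ← pow_add]
    exact hami 13 (by norm_num)
  have hnpos : 0 < n := lt_of_lt_of_le (hp 39) hn39
  have ht : n / m ^ 5 * m ^ 5 ≤ n := Nat.div_mul_le_self _ _
  have h2m : ∀ i, 10000 * m ^ i ≤ m ^ (i + 1) := by
    intro i
    rw [pow_succ']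
    exact Nat.mul_le_mul_right _ hm
  -- With n ≈ 2^m up to powers of m, taking a ≈ 2^(m/2) balances the two hitting rounds. All
  -- auxiliary sets then stay below n/m^2 elements, which at O(m) bits per element costs only
  -- O(n/m).
  refine ⟨n / m ^ 5, a, m ^ 8, 8 * m * a, n / m ^ 3, 8 * m ^ 2, ?_, hapos, ?_, ?_, ?_, ?_, ?_, ?_,
    ?_, ?_⟩
  · exact Nat.div_pos (hlow 5 (by norm_num)) (hp 5)
  · have h1 := hdiv 5 (by norm_num)
    have h2 : 8 * (n * m ^ 2) ≤ 2 * (n / m ^ 5 * m ^ 8) := by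
      calc 8 * (n * m ^ 2) ≤ m * (n * m ^ 2) := Nat.mul_le_mul_right _ (by omega)
        _ = n * m ^ 3 := by ring
        _ ≤ 2 * (n / m ^ 5 * m ^ 5) * m ^ 3 := Nat.mul_le_mul_right _ h1
        _ = _ := by ring
    omega
  · calc (m + 12) * (2 ^ m + 1) ≤ (2 * m) * (4 * (a * a)) := by
          apply Nat.mul_le_mul (by omega)
          have := Nat.one_le_two_pow (n := m)
          omega
      _ = a * (8 * m * a) := by ring
  · rw [Nat.le_div_iff_mul_le (hp 2)]
    refine le_trans ?_ (hami 11 (by norm_num))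
    have h1 : 10000 * m ^ 8 ≤ m ^ 9 := h2m 8
    have h2 : m ≤ m ^ 8 := Nat.le_self_pow (by norm_num) m
    have h3 : m ^ 8 + 8 * m ≤ m ^ 9 := by omega
    calc (a * m ^ 8 + 8 * m * a) * m ^ 2 = a * (m ^ 8 + 8 * m) * m ^ 2 := by ring
      _ ≤ a * m ^ 9 * m ^ 2 := Nat.mul_le_mul_right _ (Nat.mul_le_mul_left _ h3)
      _ = a * m ^ 11 := by ring
  · exact Nat.div_le_div_left (Nat.pow_le_pow_right hmpos (by norm_num)) (hp 2)
  · rw [Nat.le_div_iff_mul_le (hp 2)]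
    refine le_trans ?_ (hlow 5 (by norm_num))
    have h1 : 10000 * m ^ 4 ≤ m ^ 5 := h2m 4
    have h2 : m ^ 2 ≤ m ^ 4 := Nat.pow_le_pow_right hmpos (by norm_num)
    calc (8 * m ^ 2 + 1) * m ^ 2 = 8 * m ^ 4 + m ^ 2 := by ring
      _ ≤ m ^ 5 := by omega
  · calc _ ≤ 4 * (n * m ^ 2) := hck
      _ ≤ 8 * (n * m ^ 2) := by omega
      _ = _ := by ring
  · have h1 := hdiv 3 (by norm_num)
    have h2 : 2 * m ^ 5 * ((n / m ^ 5 + a * m ^ 8) * (1024 * (2 ^ m + 1))) ≤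
        2 * m ^ 5 * (n / m ^ 3 * n) := by
      calc 2 * m ^ 5 * ((n / m ^ 5 + a * m ^ 8) * (1024 * (2 ^ m + 1)))
          ≤ 2 * m ^ 5 * ((2 * (n / m ^ 5)) * (1024 * (2 * (n * m)))) := by
            gcongr
            omega
        _ = 8192 * ((n / m ^ 5 * m ^ 5) * (n * m)) := by ring
        _ ≤ m * (n * (n * m)) := by
            gcongr
            omega
        _ = n * (m ^ 2 * n) := by ring
        _ ≤ (2 * (n / m ^ 3 * m ^ 3)) * (m ^ 2 * n) := by gcongr
        _ = _ := by ring
    exact Nat.le_of_mul_le_mul_left h2 (by positivity)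
  · have h1 : n / m ^ 3 ≤ n := Nat.div_le_self _ _
    have h2 : n / m ^ 5 ≤ n := Nat.div_le_self _ _
    have h3 : n * 6 ≤ n * q := Nat.mul_le_mul_left _ hq
    omega

/-- The gap 4000q pays for the rank excess 1100q, the deficit nq in the sumset, the small sets and a
final margin of n bits. -/
theorem small_exponent_le {n m q : ℕ} (hq : 2000 ≤ q) (hqm : q * q ≤ m) (hmn : m ≤ n)
    (hgap : n * (m + 4000 * q) ≤ 2 ^ (m + 1)) :
    (n + 1) * (m + 1100 * q) + (m + 1100 * q + 1) * (n / m ^ 2) * 4 + n ≤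
      2 ^ (m + 1) - n * q := by
  have hr : m + 1100 * q + 1 ≤ 3 * m := by nlinarith
  have hmpos : 0 < m := by nlinarith
  have h1 : (m + 1100 * q + 1) * (n / m ^ 2) ≤ 3 * n := by
    calc (m + 1100 * q + 1) * (n / m ^ 2) ≤ 3 * m * (n / m ^ 2) := Nat.mul_le_mul_right _ hr
      _ ≤ 3 * m ^ 2 * (n / m ^ 2) := by
        apply Nat.mul_le_mul_right
        nlinarith
      _ = 3 * (m ^ 2 * (n / m ^ 2)) := by ring
      _ ≤ 3 * n := Nat.mul_le_mul_left _ (Nat.mul_div_le _ _)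
  have h2 : n * 2000 ≤ n * q := Nat.mul_le_mul_left _ hq
  apply Nat.le_sub_of_add_le
  have h3 : n * (m + 4000 * q) = n * m + 4000 * (n * q) := by ring
  have h4 : (n + 1) * (m + 1100 * q) = n * m + 1100 * (n * q) + (m + 1100 * q) := by ring
  omega

end Numerics

/-! ### Sets of 2^m + 1 elements, by doubling. -/

section IndependentSets

open Finset
open scoped Pointwise

variable {G : Type*} [AddCommGroup G] [Module (ZMod 2) G] [DecidableEq G] [Fintype G]

theorem mem_sumNeighbourSubsets_of_zero_mem {X : Finset G} {m n : ℕ} (h0 : 0 ∈ X)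
    (hX : #X = 2 ^ m + 1) (hn : 0 < n) (h4 : 4 * n ≤ 2 ^ m) :
    X ∈ sumNeighbourSubsets G (10 * (#(X + X) / (2 ^ m + 1) + 1) + 2 * m + 2) (4 * n)
      (#(X + X) / (3 * n)) n (2 ^ m + 1) #(X + X) := by
  have hlt := Nat.lt_mul_div_succ #(X + X) (show 0 < 2 ^ m + 1 by positivity)
  obtain ⟨R, hrank, hR⟩ := finrank_span_le_of_card_add_le X h0
    (#(X + X) / (2 ^ m + 1) + 1) 8 (by norm_num) (by rw [hX, mul_comm]; exact hlt.le)
  have hR' := rank_excess_le (m := m) (by rw [hX, pow_succ]; have := Nat.one_le_two_pow (n := m);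
                                          omega) hR
  have := mem_sumNeighbourSubsets (X := X)
    (r := 10 * (#(X + X) / (2 ^ m + 1) + 1) + 2 * m + 2) (a := 4 * n)
    (p := #(X + X) / (3 * n)) (by omega) hn le_rfl (by omega)
    (Nat.lt_mul_div_succ _ (by omega))
  rwa [hX] at this

/-- Let Y ⊆ X be a small set whose sumset covers the popular sums of X. If Y + Y is nearly as large
as 2^(m+1), then Y alone serves in the union bound; otherwise Q = Y + Y is small enough to
reconstruct X. -/
theorem exists_lowRank_or_mem_nearTranslateSets {X : Finset G} {n m q : ℕ} (h0 : 0 ∈ X)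
    (hX : #X = 2 ^ m + 1) (hσ : #(X + X) < 1024 * (2 ^ m + 1)) (hm : 10000 ≤ m) (hq : 100 ≤ q)
    (hqm : m < (q + 1) * (q + 1)) (hn : 2 ^ m ≤ n * m) (hpow : m ^ 40 ≤ 2 ^ m)
    (hgap : n * (m + 4000 * q) ≤ 2 ^ (m + 1)) :
    (∃ Y ∈ lowRankSubsets G (m + 1100 * q) (n / m ^ 2), Y ⊆ X ∧
      2 ^ (m + 1) - n * q ≤ #(Y + Y)) ∨ X ∈ nearTranslateSets G (m + 1100 * q) (n / m ^ 2) := by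
  obtain ⟨R, hrank, hR⟩ := finrank_span_le_of_card_add_le X h0 1024 q (by omega)
    (by rw [hX]; exact hσ.le)
  have hR' := rank_excess_le_of_sqrt (by omega) hqm (by
    rw [hX, pow_succ]; have := Nat.one_le_two_pow (n := m); omega) hR
  -- The bound 1024q + (m + 6q + 30) + 2048, absorbed using q ≥ 100.
  have hr : Module.finrank (ZMod 2) (Submodule.span (ZMod 2) (X : Set G)) ≤ m + 1100 * q := by
    omega
  obtain ⟨t, a, h₁, h₂, e, h', ht, ha, hth, hah, hy, hey, hhy, hnh, hτ, hsum⟩ :=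
    small_parameters (q := q) hm (by omega) hn hpow
  have hnpos : 0 < n := by
    rcases Nat.eq_zero_or_pos n with rfl | h
    · have := Nat.one_le_two_pow (n := m)
      omega
    · exact h
  have hcσ : #(X + X) < 2 ^ (m + 12) := by
    have := Nat.one_le_two_pow (n := m)
    rw [pow_add]
    omega
  obtain ⟨Y, hYX, hYc, hPY⟩ := exists_subset_covering_popular X
    ((X + X).filter (fun w => t + a * h₁ ≤ #(X.filter (fun y => w + y ∈ X)))) (c := m + 12) ht ha
    (fun w hw => (mem_filter.1 hw).2) ((card_filter_le _ _).trans_lt hcσ)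
    (by rw [hX]; exact hth) (by rw [hX]; exact hah)
  by_cases hQ : 2 ^ (m + 1) - n * q ≤ #(Y + Y)
  · exact Or.inl ⟨Y, mem_lowRankSubsets hr hYX (hYc.trans hy), hYX, hQ⟩
  right
  have hQX : #(Y + Y) ≤ #(X + X) := card_le_card (add_subset_add hYX hYX)
  obtain ⟨Y', hY'X, hY'c, hd1, hd2⟩ := exists_commonTranslates_approx X (Y + Y) (m := m) (h := n)
    (τ := t + a * h₁) (e := e) (h' := h') (c := m + 12) hX (by omega) hnpos
    (fun w hw hw' => hPY (mem_filter.2 ⟨hw, hw'⟩)) (by omega)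
    ((Nat.mul_le_mul_left _ hσ.le).trans hτ) (by omega) (by rw [hX]; exact hnh)
  exact mem_nearTranslateSets hr hYX (hYc.trans hy) hY'X (hY'c.trans hhy) (hd1.trans hey)
    (hd2.trans hey)

omit [Fintype G] in
-- In characteristic 2 translating by x shifts X + X by 2x = 0. So 0 ∈ X may be assumed, as the rank
-- bounds require.
theorem exists_translate_zero_mem {X : Finset G} (hX : X.Nonempty) :
    ∃ X' : Finset G, 0 ∈ X' ∧ #X' = #X ∧ X' + X' = X + X := by
  obtain ⟨x, hx⟩ := hX
  refine ⟨X.image (fun y => x + y), mem_image.2 ⟨x, hx, ZModModule.add_self x⟩,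
    card_image_of_injective _ (add_right_injective x), ?_⟩
  ext w
  simp only [Finset.mem_add, mem_image]
  constructor
  · rintro ⟨_, ⟨y, hy, rfl⟩, _, ⟨z, hz, rfl⟩, rfl⟩
    exact ⟨y, hy, z, hz, by rw [add_add_add_comm, ZModModule.add_self, zero_add]⟩
  · rintro ⟨y, hy, z, hz, rfl⟩
    exact ⟨x + y, ⟨y, hy, rfl⟩, x + z, ⟨z, hz, rfl⟩, by
      rw [add_add_add_comm, ZModModule.add_self, zero_add]⟩

theorem card_sumNeighbourSubsets_le_two_pow {n m σ : ℕ} (hG : Fintype.card G = 2 ^ n)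
    (hm : 100000 ≤ m) (hmn : m ≤ n) (hn : 2 ^ m ≤ n * m) (hnm : n * m ≤ 2 ^ (m + 1))
    (hσ : 1024 * (2 ^ m + 1) ≤ σ) :
    ∃ E, 8 * E ≤ 7 * σ ∧ #((sumNeighbourSubsets G (10 * (σ / (2 ^ m + 1) + 1) + 2 * m + 2) (4 * n)
      (σ / (3 * n)) n (2 ^ m + 1) σ)) ≤ 2 ^ E := by
  set k := 2 ^ m + 1 with hk
  set κ := σ / k with hκ
  set p := σ / (3 * n) with hp
  have hkpos : 0 < k := by omega
  have hκ1 : 1024 ≤ κ := (Nat.le_div_iff_mul_le hkpos).2 hσ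
  have hκk : κ * k ≤ σ := Nat.div_mul_le_self _ _
  have hσk : σ ≤ (κ + 1) * k := by
    rw [mul_comm]
    exact (Nat.lt_mul_div_succ σ hkpos).le
  have hpn : 3 * n * p ≤ σ := Nat.mul_div_le _ _
  have hkn : k ≤ 2 * (n * m) := by
    have := Nat.one_le_two_pow (n := m)
    omega
  have hnpos : 0 < n := by omega
  have hpk : p ≤ (κ + 1) * n := by
    have hmn2 : k ≤ 3 * (n * n) := hkn.trans (by nlinarith)
    refine Nat.le_of_mul_le_mul_left ?_ (show 0 < 3 * n by omega)
    calc 3 * n * p ≤ (κ + 1) * k := hpn.trans hσk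
      _ ≤ (κ + 1) * (3 * (n * n)) := Nat.mul_le_mul_left _ hmn2
      _ = 3 * n * ((κ + 1) * n) := by ring
  have hM : (4 * n + p) * σ ≤ n * ((κ + 5) * (κ + 1) * k) := by
    calc (4 * n + p) * σ ≤ (4 * n + (κ + 1) * n) * ((κ + 1) * k) := by gcongr
      _ = _ := by ring
  have h1 := card_sumNeighbourSubsets_le hG (10 * (κ + 1) + 2 * m + 2) (4 * n) p k σ _ hnpos hM
  have h2 : ((κ + 5) * (κ + 1) * k).choose k ≤ 2 ^ (κ / 8 * k) := by
    apply choose_le_two_pow hkpos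
    rw [← mul_assoc]
    exact Nat.mul_le_mul_right _ (three_mul_le_two_pow hκ1)
  refine ⟨_, large_exponent_le (n := n) (m := m) (k := k) (κ := κ) (σ := σ) (p := p) ?_ hm hmn hκk
    hσ hpn, ?_⟩
  · rw [pow_succ] at hnm
    omega
  · rw [pow_add]
    exact h1.trans (Nat.mul_le_mul_left _ h2)

end IndependentSets

/-! ### No independent set has 2^m + 1 elements. -/

section Probability

open Finset
open scoped Pointwise

/-- The 6 comes from three families, each contributing 2 * 2^(-n): large doubling, small doubling
seen through Y, and small doubling with X reconstructed. -/
theorem randomSubset_real_exists_sum_free_le {n m q : ℕ} (hq : 2000 ≤ q) (hqm : q * q ≤ m)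
    (hqm' : m < (q + 1) * (q + 1)) (hn : 2 ^ m ≤ n * m) (hpow : m ^ 40 ≤ 2 ^ m)
    (hgap : n * (m + 4000 * q) ≤ 2 ^ (m + 1)) :
    (randomSubset n).real {A | ∃ X : Finset (Fin n → ZMod 2), #X = 2 ^ m + 1 ∧
      ∀ w ∈ X + X, w ≠ 0 → w ∉ A} ≤ 6 * (1 / 2) ^ n := by
  have hG : Fintype.card (Fin n → ZMod 2) = 2 ^ n := by simp [ZMod.card]
  have hm : 100000 ≤ m := by nlinarith
  have hmn : m ≤ n := by
    have h1 : m ^ 39 ≤ n := by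
      refine Nat.le_of_mul_le_mul_right ?_ (show 0 < m by omega)
      calc m ^ 39 * m = m ^ 40 := (pow_succ _ _).symm
        _ ≤ _ := hpow.trans hn
    exact (Nat.le_self_pow (by norm_num) m).trans h1
  have hnm : n * m ≤ 2 ^ (m + 1) := (Nat.mul_le_mul_left _ (Nat.le_add_right _ _)).trans hgap
  have hnk : 4 * n ≤ 2 ^ m := by
    have h1 : n * 8 ≤ n * m := Nat.mul_le_mul_left _ (by omega)
    rw [pow_succ] at hnm
    omega
  set k := 2 ^ m + 1 with hk
  set G := Fin n → ZMod 2 with hGdef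
  let fam : ℕ → Finset (Finset G) := fun σ =>
    (sumNeighbourSubsets G (10 * (σ / k + 1) + 2 * m + 2) (4 * n) (σ / (3 * n)) n k σ).filter
      (fun X => #(X + X) = σ)
  let fam₂ := (lowRankSubsets G (m + 1100 * q) (n / m ^ 2)).filter
    (fun Y => 2 ^ (m + 1) - n * q ≤ #(Y + Y))
  let fam₃ := (nearTranslateSets G (m + 1100 * q) (n / m ^ 2)).filter
    (fun X => 2 ^ (m + 1) - n * q ≤ #(X + X))
  have hexp := small_exponent_le hq hqm hmn hgap
  have hsub : {A : Set G | ∃ X : Finset G, #X = k ∧ ∀ w ∈ X + X, w ≠ 0 → w ∉ A} ⊆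
      ((⋃ σ ∈ Icc (1024 * k) (k * k), {A : Set G | ∃ X ∈ fam σ, ∀ w ∈ X + X, w ≠ 0 → w ∉ A}) ∪
      {A | ∃ Y ∈ fam₂, ∀ w ∈ Y + Y, w ≠ 0 → w ∉ A}) ∪
      {A | ∃ X ∈ fam₃, ∀ w ∈ X + X, w ≠ 0 → w ∉ A} := by
    rintro A ⟨X₀, hX₀, hA₀⟩
    obtain ⟨X, h0, hXc, hXX⟩ := exists_translate_zero_mem (X := X₀) (card_pos.1 (by omega))
    rw [hX₀] at hXc
    rw [← hXX] at hA₀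
    by_cases hσ : 1024 * k ≤ #(X + X)
    · refine Or.inl (Or.inl ?_)
      simp only [Set.mem_iUnion]
      refine ⟨#(X + X), mem_Icc.2 ⟨hσ, ?_⟩, X, mem_filter.2 ⟨?_, rfl⟩, hA₀⟩
      · rw [← hXc]
        exact card_add_le
      · exact mem_sumNeighbourSubsets_of_zero_mem h0 hXc (by omega) hnk
    · rcases exists_lowRank_or_mem_nearTranslateSets (n := n) (q := q) h0 hXc (by omega) (by omega)
        (by omega) hqm' hn hpow hgap with ⟨Y, hY, hYX, hYc⟩ | hXn
      · refine Or.inl (Or.inr ⟨Y, mem_filter.2 ⟨hY, hYc⟩, fun w hw => hA₀ w ?_⟩)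
        exact add_subset_add hYX hYX hw
      · refine Or.inr ⟨X, mem_filter.2 ⟨hXn, ?_⟩, hA₀⟩
        exact (Nat.sub_le _ _).trans (two_pow_succ_le_card_add_self (by omega))
  have hhalf : ∀ a b : ℕ, (2 : ℝ) ^ a * (1 / 2) ^ (a + b) = (1 / 2) ^ b := by
    intro a b
    rw [pow_add, ← mul_assoc, ← mul_pow]
    norm_num
  have hcount : ∀ {N a c b : ℕ}, N ≤ 2 ^ a → a + b ≤ c →
      ((N : ℝ) * (2 * (1 / 2) ^ c)) ≤ 2 * (1 / 2) ^ b := by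
    intro N a c b hN hac
    have h1 : (N : ℝ) ≤ 2 ^ a := by exact_mod_cast hN
    calc (N : ℝ) * (2 * (1 / 2) ^ c) ≤ 2 ^ a * (2 * (1 / 2) ^ (a + b)) := by
          gcongr ?_ * (2 * ?_)
          exact pow_le_pow_of_le_one (by norm_num) (by norm_num) hac
      _ = 2 * (1 / 2) ^ b := by
          rw [mul_left_comm, hhalf]
  have hP2 : (randomSubset n).real {A | ∃ Y ∈ fam₂, ∀ w ∈ Y + Y, w ≠ 0 → w ∉ A} ≤
      2 * (1 / 2) ^ n := by
    refine (randomSubset_real_exists_avoid_le fam₂ (fun Y => Y + Y)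
      (fun Y hY => (mem_filter.1 hY).2) ((card_filter_le _ _).trans
        (card_lowRankSubsets_le hG _ _))).trans ?_
    refine hcount le_rfl ?_
    have : (m + 1100 * q + 1) * (n / m ^ 2) ≤ (m + 1100 * q + 1) * (n / m ^ 2) * 4 :=
      Nat.le_mul_of_pos_right _ (by norm_num)
    omega
  have hP3 : (randomSubset n).real {A | ∃ X ∈ fam₃, ∀ w ∈ X + X, w ≠ 0 → w ∉ A} ≤
      2 * (1 / 2) ^ n := by
    refine (randomSubset_real_exists_avoid_le fam₃ (fun Y => Y + Y)
      (fun Y hY => (mem_filter.1 hY).2) ((card_filter_le _ _).trans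
        (card_nearTranslateSets_le hG _ _))).trans ?_
    exact hcount le_rfl hexp
  have hP1 : (randomSubset n).real
      (⋃ σ ∈ Icc (1024 * k) (k * k), {A : Set G | ∃ X ∈ fam σ, ∀ w ∈ X + X, w ≠ 0 → w ∉ A}) ≤
      2 * (1 / 2) ^ n := by
    -- For each σ the count leaves σ/8 ≥ 128k bits unspent, enough to sum over at most k^2 values of
    -- σ.
    have h1 : ∀ σ ∈ Icc (1024 * k) (k * k), (randomSubset n).real
        {A : Set G | ∃ X ∈ fam σ, ∀ w ∈ X + X, w ≠ 0 → w ∉ A} ≤ 2 * (1 / 2) ^ (128 * k) := by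
      intro σ hσ
      rw [mem_Icc] at hσ
      obtain ⟨E, hE, hcard⟩ := card_sumNeighbourSubsets_le_two_pow (G := G) hG hm hmn hn hnm hσ.1
      refine (randomSubset_real_exists_avoid_le (fam σ) (fun Y => Y + Y)
        (fun Y hY => (mem_filter.1 hY).2.ge) ((card_filter_le _ _).trans hcard)).trans ?_
      exact hcount le_rfl (by omega)
    calc _ ≤ ∑ σ ∈ Icc (1024 * k) (k * k), (randomSubset n).real
          {A : Set G | ∃ X ∈ fam σ, ∀ w ∈ X + X, w ≠ 0 → w ∉ A} :=
          measureReal_biUnion_finset_le _ _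
      _ ≤ ∑ σ ∈ Icc (1024 * k) (k * k), 2 * (1 / 2) ^ (128 * k) := sum_le_sum h1
      _ = (#(Icc (1024 * k) (k * k)) : ℝ) * (2 * (1 / 2) ^ (128 * k)) := by
          rw [sum_const, nsmul_eq_mul]
      _ ≤ 2 * (1 / 2) ^ n := by
          refine hcount (a := 2 * k) ?_ (by omega)
          have hk2 : k < 2 ^ k := Nat.lt_two_pow_self
          calc #(Icc (1024 * k) (k * k)) ≤ k * k := by rw [Nat.card_Icc]; omega
            _ ≤ 2 ^ k * 2 ^ k := Nat.mul_le_mul hk2.le hk2.le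
            _ = 2 ^ (2 * k) := by rw [← pow_add, two_mul]
  refine (measureReal_mono hsub).trans ((measureReal_union_le _ _).trans ?_)
  have := measureReal_union_le (μ := randomSubset n)
    (⋃ σ ∈ Icc (1024 * k) (k * k), {A : Set G | ∃ X ∈ fam σ, ∀ w ∈ X + X, w ≠ 0 → w ∉ A})
    {A | ∃ Y ∈ fam₂, ∀ w ∈ Y + Y, w ≠ 0 → w ∉ A}
  linarith

end Probability

/-! ### The second moment inequality. -/

section SecondMoment

open Finset

variable {n : ℕ}

/-- Second moment bound for the probability that a random set meets every member of a family of
equally large sets. -/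
theorem randomSubset_real_hit_all_mul_sq_le {ι : Type*} (s : Finset ι)
    (C : ι → Finset (Fin n → ZMod 2)) {c : ℕ} (hc : ∀ i ∈ s, #(C i) = c) :
    (randomSubset n).real {A | ¬ ∃ i ∈ s, ∀ w ∈ C i, w ∉ A} * (#s : ℝ) ^ 2 ≤
      ∑ i ∈ s, ∑ j ∈ s, ((2 : ℝ) ^ #(C i ∩ C j) - 1) := by
  classical
  set μ := randomSubset n with hμ
  let E : ι → Set (Set (Fin n → ZMod 2)) := fun i => {A | ∀ w ∈ C i, w ∉ A}
  have hE : ∀ i, MeasurableSet (E i) := fun i => (Set.toFinite _).measurableSet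
  let f : ι → Set (Fin n → ZMod 2) → ℝ := fun i => (E i).indicator 1
  have hint : ∀ g : Set (Fin n → ZMod 2) → ℝ, Integrable g μ := fun g => Integrable.of_finite
  have hf : ∀ i ∈ s, ∫ A, f i A ∂μ = (1 / 2) ^ c := by
    intro i hi
    rw [integral_indicator_one (hE i), randomSubset_real_disjoint, hc i hi]
  have hff : ∀ i ∈ s, ∀ j ∈ s, ∫ A, f i A * f j A ∂μ =
      (1 / 2) ^ c * (1 / 2) ^ c * 2 ^ #(C i ∩ C j) := by
    intro i hi j hj
    have h1 : (fun A => f i A * f j A) = (E i ∩ E j).indicator 1 := by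
      rw [Set.inter_indicator_one]
      rfl
    have h2 : E i ∩ E j = {A | ∀ w ∈ C i ∪ C j, w ∉ A} := by
      ext A
      simp only [E, Set.mem_inter_iff, Set.mem_ofPred_eq, mem_union]
      exact ⟨fun h w hw => hw.elim (h.1 w) (h.2 w),
        fun h => ⟨fun w hw => h w (Or.inl hw), fun w hw => h w (Or.inr hw)⟩⟩
    rw [h1, integral_indicator_one ((hE i).inter (hE j)), h2, randomSubset_real_disjoint]
    have h3 := card_union_add_card_inter (C i) (C j)
    rw [hc i hi, hc j hj] at h3
    rw [← pow_add, ← h3, pow_add, mul_assoc, ← mul_pow]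
    norm_num
  set p : ℝ := (1 / 2) ^ c with hp
  have hp0 : 0 < p := by positivity
  have hsq : ∫ A, (∑ i ∈ s, f i A - #s * p) ^ 2 ∂μ =
      p * p * ∑ i ∈ s, ∑ j ∈ s, ((2 : ℝ) ^ #(C i ∩ C j) - 1) := by
    have h1 : ∀ A, (∑ i ∈ s, f i A - #s * p) ^ 2 =
        ∑ i ∈ s, ∑ j ∈ s, f i A * f j A - 2 * (#s * p) * ∑ i ∈ s, f i A + (#s * p) ^ 2 := by
      intro A
      rw [← sum_mul_sum]
      ring
    simp_rw [h1]
    rw [integral_add (hint _) (hint _), integral_sub (hint _) (hint _), integral_const_mul,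
      integral_finsetSum _ (fun i _ => hint _), integral_finsetSum _ (fun i _ => hint _),
      sum_congr rfl hf]
    have h2 : ∀ i ∈ s, ∫ A, ∑ j ∈ s, f i A * f j A ∂μ =
        ∑ j ∈ s, p * p * 2 ^ #(C i ∩ C j) := by
      intro i hi
      rw [integral_finsetSum _ (fun j _ => hint _)]
      exact sum_congr rfl (hff i hi)
    rw [sum_congr rfl h2]
    simp only [integral_const, sum_const, nsmul_eq_mul, sum_sub_distrib, probReal_univ, one_smul,
      mul_sub, mul_sum, mul_one]
    ring
  have hB : MeasurableSet {A : Set (Fin n → ZMod 2) | ¬ ∃ i ∈ s, ∀ w ∈ C i, w ∉ A} :=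
    (Set.toFinite _).measurableSet
  -- Chebyshev: on this event the count vanishes, so its squared deviation equals the square of its
  -- mean.
  have hle : μ.real {A | ¬ ∃ i ∈ s, ∀ w ∈ C i, w ∉ A} * (#s * p) ^ 2 ≤
      ∫ A, (∑ i ∈ s, f i A - #s * p) ^ 2 ∂μ := by
    rw [← integral_indicator_one hB, ← integral_mul_const]
    refine integral_mono (hint _) (hint _) fun A => ?_
    by_cases hA : A ∈ {A : Set (Fin n → ZMod 2) | ¬ ∃ i ∈ s, ∀ w ∈ C i, w ∉ A}
    · have h0 : ∑ i ∈ s, f i A = 0 := by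
        refine sum_eq_zero fun i hi => ?_
        apply Set.indicator_of_notMem
        exact fun h => hA ⟨i, hi, h⟩
      simp only [Set.indicator_of_mem hA, h0, Pi.one_apply]
      apply le_of_eq
      ring
    · simp only [Set.indicator_of_notMem hA]
      rw [zero_mul]
      positivity
  rw [hsq] at hle
  have h2 : p * p * (μ.real {A | ¬ ∃ i ∈ s, ∀ w ∈ C i, w ∉ A} * (#s : ℝ) ^ 2) ≤
      p * p * ∑ i ∈ s, ∑ j ∈ s, ((2 : ℝ) ^ #(C i ∩ C j) - 1) := by
    refine le_trans (le_of_eq ?_) hle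
    ring
  exact le_of_mul_le_mul_left h2 (by positivity)

end SecondMoment

/-! ### Counting bases by their intersection with a fixed subspace. -/

section Subspaces

open Finset

variable {G : Type*} [AddCommGroup G] [Module (ZMod 2) G] [Fintype G]

/-- Independent coefficient rows make w ↦ (∑ c i j • w j mod V) surjective onto (G/V)^d, so its
kernel has dimension nm - d(n - m). -/
theorem natCard_ker_le {n m d : ℕ} (hG : Module.finrank (ZMod 2) G = n)
    (V : Submodule (ZMod 2) G) (hV : Module.finrank (ZMod 2) V = m)
    (c : Fin d → Fin m → ZMod 2) (hc : LinearIndependent (ZMod 2) c) :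
    Nat.card {w : Fin m → G // ∀ i, ∑ j, c i j • w j ∈ V} * 2 ^ (n * d) =
      2 ^ (n * m) * 2 ^ (m * d) := by
  let T : (Fin m → G) →ₗ[ZMod 2] (Fin d → G ⧸ V) :=
    LinearMap.pi fun i => V.mkQ ∘ₗ ∑ j, c i j • LinearMap.proj j
  have hT : ∀ w i, T w i = V.mkQ (∑ j, c i j • w j) := by
    intro w i
    simp [T]
  have hsurj : Function.Surjective T := by
    intro u
    have hinj : LinearMap.ker (Fintype.linearCombination (ZMod 2) c) = ⊥ :=
      LinearMap.ker_eq_bot.2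
        (LinearIndependent.fintypeLinearCombination_injective hc)
    obtain ⟨g, hg⟩ := LinearMap.exists_leftInverse_of_injective _ hinj
    have hgc : ∀ i, g (c i) = Pi.single i 1 := by
      intro i
      have := LinearMap.congr_fun hg (Pi.single i 1)
      simpa [Fintype.linearCombination_apply_single] using this
    choose u' hu' using fun i => Submodule.mkQ_surjective V (u i)
    refine ⟨fun j => ∑ i, g (Pi.single j 1) i • u' i, ?_⟩
    ext i
    rw [hT, ← hu']
    congr 1
    calc ∑ j, c i j • ∑ i', g (Pi.single j 1) i' • u' i'
        = ∑ i', (∑ j, c i j • g (Pi.single j 1)) i' • u' i' := by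
          simp only [smul_sum, smul_smul, Finset.sum_apply, Pi.smul_apply, smul_eq_mul, sum_smul]
          exact sum_comm
      _ = ∑ i', g (c i) i' • u' i' := by
          have : g (c i) = ∑ j, c i j • g (Pi.single j 1) := by
            conv_lhs => rw [pi_eq_sum_univ' (c i)]
            simp [map_sum, map_smul]
          rw [this]
      _ = u' i := by
          rw [hgc]
          simp [Pi.single_apply]
  have hker : Nat.card {w : Fin m → G // ∀ i, ∑ j, c i j • w j ∈ V} =
      Nat.card (LinearMap.ker T) := by
    apply Nat.card_congr
    refine Equiv.subtypeEquivRight fun w => ?_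
    rw [LinearMap.mem_ker, funext_iff]
    refine forall_congr' fun i => ?_
    rw [hT]
    exact (Submodule.Quotient.mk_eq_zero V).symm
  have hrank := LinearMap.finrank_range_add_finrank_ker T
  rw [LinearMap.range_eq_top.2 hsurj, finrank_top, Module.finrank_pi_fintype,
    Module.finrank_pi_fintype, sum_const, sum_const, card_univ, card_univ, Fintype.card_fin,
    Fintype.card_fin, smul_eq_mul, smul_eq_mul, hG] at hrank
  have hq := Submodule.finrank_quotient_add_finrank V
  rw [hV, hG] at hq
  rw [hker, Module.natCard_eq_pow_finrank (K := ZMod 2), Nat.card_zmod, ← pow_add, ← pow_add]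
  congr 1
  rw [← hq] at hrank ⊢
  nlinarith

theorem exists_coefficients {m d : ℕ} (V : Submodule (ZMod 2) G) (w : Fin m → G)
    (hd : Module.finrank (ZMod 2) ↥(V ⊓ Submodule.span (ZMod 2) (Set.range w)) = d) :
    ∃ c : Fin d → Fin m → ZMod 2, LinearIndependent (ZMod 2) c ∧
      ∀ i, ∑ j, c i j • w j ∈ V := by
  obtain ⟨b⟩ : Nonempty (Module.Basis (Fin d) (ZMod 2)
      ↥(V ⊓ Submodule.span (ZMod 2) (Set.range w))) :=
    ⟨Module.finBasisOfFinrankEq (ZMod 2) _ hd⟩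
  have hmem : ∀ i, ∃ c : Fin m → ZMod 2, ∑ j, c j • w j = (b i : G) := fun i =>
    (Submodule.mem_span_range_iff_exists_fun (ZMod 2)).1 (b i).2.2
  choose c hc using hmem
  refine ⟨c, ?_, fun i => by rw [hc]; exact (b i).2.1⟩
  apply LinearIndependent.of_comp (Fintype.linearCombination (ZMod 2) w)
  have : (Fintype.linearCombination (ZMod 2) w) ∘ c = fun i => (b i : G) := by
    ext i
    simp [Fintype.linearCombination_apply, hc]
  rw [this]
  have hb := b.linearIndependent.map' (Submodule.subtype _) (Submodule.ker_subtype _)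
  exact hb

open Classical in
/-- Few bases meet a given subspace in a given dimension. -/
theorem card_filter_finrank_inf_le {n m d : ℕ} (hG : Module.finrank (ZMod 2) G = n)
    (V : Submodule (ZMod 2) G) (hV : Module.finrank (ZMod 2) V = m) :
    #(univ.filter (fun w : Fin m → G => LinearIndependent (ZMod 2) w ∧
      Module.finrank (ZMod 2) ↥(V ⊓ Submodule.span (ZMod 2) (Set.range w)) = d)) * 2 ^ (n * d) ≤
      2 ^ (n * m + 2 * m * d) := by
  have hsub : univ.filter (fun w : Fin m → G => LinearIndependent (ZMod 2) w ∧
      Module.finrank (ZMod 2) ↥(V ⊓ Submodule.span (ZMod 2) (Set.range w)) = d) ⊆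
      (univ.filter (fun c : Fin d → Fin m → ZMod 2 => LinearIndependent (ZMod 2) c)).biUnion
        fun c => univ.filter (fun w : Fin m → G => ∀ i, ∑ j, c i j • w j ∈ V) := by
    intro w hw
    rw [mem_filter] at hw
    obtain ⟨c, hc, hcw⟩ := exists_coefficients V w hw.2.2
    exact mem_biUnion.2 ⟨c, mem_filter.2 ⟨mem_univ _, hc⟩, mem_filter.2 ⟨mem_univ _, hcw⟩⟩
  refine (Nat.mul_le_mul_right _ ((card_le_card hsub).trans card_biUnion_le)).trans ?_
  calc (∑ c ∈ univ.filter (fun c : Fin d → Fin m → ZMod 2 => LinearIndependent (ZMod 2) c),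
        #(univ.filter (fun w : Fin m → G => ∀ i, ∑ j, c i j • w j ∈ V))) * 2 ^ (n * d)
      = ∑ c ∈ univ.filter (fun c : Fin d → Fin m → ZMod 2 => LinearIndependent (ZMod 2) c),
        2 ^ (n * m) * 2 ^ (m * d) := by
        rw [sum_mul]
        refine sum_congr rfl fun c hc => ?_
        rw [← natCard_ker_le hG V hV c (mem_filter.1 hc).2, Nat.card_eq_fintype_card,
          Fintype.card_subtype]
    _ ≤ 2 ^ (m * d) * (2 ^ (n * m) * 2 ^ (m * d)) := by
        rw [sum_const, smul_eq_mul]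
        apply Nat.mul_le_mul_right
        refine (card_filter_le _ _).trans (le_of_eq ?_)
        rw [card_univ, Fintype.card_fun, Fintype.card_fun, ZMod.card, Fintype.card_fin,
          Fintype.card_fin, pow_mul]
    _ = _ := by
        rw [← pow_add, ← pow_add]
        congr 1
        ring

end Subspaces

/-! ### Subspaces avoiding the random set, and colourings. -/

section FreeSubspace

open Finset

open Classical in
/-- The nonzero elements of a subspace as a finite set. -/
noncomputable def nonzeroElements {G : Type*} [AddCommGroup G] [Module (ZMod 2) G] [Fintype G]
    (U : Submodule (ZMod 2) G) : Finset G :=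
  univ.filter (fun x => x ∈ U ∧ x ≠ 0)

theorem mem_nonzeroElements {G : Type*} [AddCommGroup G] [Module (ZMod 2) G] [Fintype G]
    {U : Submodule (ZMod 2) G} {x : G} : x ∈ nonzeroElements U ↔ x ∈ U ∧ x ≠ 0 := by
  simp [nonzeroElements]

theorem card_nonzeroElements {G : Type*} [AddCommGroup G] [Module (ZMod 2) G] [Fintype G]
    (U : Submodule (ZMod 2) G) :
    #(nonzeroElements U) + 1 = 2 ^ Module.finrank (ZMod 2) U := by
  classical
  have h1 : nonzeroElements U = (univ.filter (fun x => x ∈ U)).erase 0 := by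
    ext x
    simp [mem_nonzeroElements, and_comm]
  have h2 : #(univ.filter (fun x => x ∈ U)) = Nat.card U := by
    rw [Nat.card_eq_fintype_card, Fintype.card_subtype]
  have h3 : (0 : G) ∈ univ.filter (fun x => x ∈ U) := by simp
  rw [h1, card_erase_add_one h3, h2, Module.natCard_eq_pow_finrank (K := ZMod 2), Nat.card_zmod]

theorem nonzeroElements_inter {G : Type*} [AddCommGroup G] [Module (ZMod 2) G] [Fintype G]
    [DecidableEq G] (U W : Submodule (ZMod 2) G) :
    nonzeroElements U ∩ nonzeroElements W = nonzeroElements (U ⊓ W) := by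
  ext x
  simp only [mem_inter, mem_nonzeroElements, Submodule.mem_inf]
  tauto

open Classical in
theorem two_pow_le_card_linearIndependent {n m : ℕ} (hmn : m ≤ n) :
    2 ^ (n * m) ≤ #(univ.filter (fun w : Fin m → Fin n → ZMod 2 => LinearIndependent (ZMod 2) w)) *
      2 ^ m := by
  have hfin : Module.finrank (ZMod 2) (Fin n → ZMod 2) = n := by simp
  rw [← Fintype.card_subtype, ← Nat.card_eq_fintype_card,
    card_linearIndependent (by rw [hfin]; exact hmn), hfin, ZMod.card]
  calc 2 ^ (n * m) = ∏ _i : Fin m, 2 ^ n := by simp [pow_mul]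
    _ ≤ ∏ i : Fin m, (2 ^ n - 2 ^ (i : ℕ)) * 2 := by
        apply prod_le_prod' 
        intro i _
        have h1 : 2 ^ (i : ℕ) * 2 ≤ 2 ^ n := by
          rw [← pow_succ]
          exact Nat.pow_le_pow_right (by norm_num) (by omega)
        omega
    _ = _ := by rw [prod_mul_distrib]; simp

open Classical in
-- Split by the dimension d of the intersection. At most 2^(nm + 2md - nd) bases have a given d,
-- each with weight below 2^(2^d), so `hexp` leaves a saving of 2^(3m) for every d ≥ 1; d = 0
-- contributes nothing.
theorem sum_two_pow_card_inter_le {n m : ℕ} (V : Submodule (ZMod 2) (Fin n → ZMod 2))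
    (hV : Module.finrank (ZMod 2) V = m)
    (hexp : ∀ d, 1 ≤ d → d ≤ m → 2 ^ d + 2 * m * d + 3 * m ≤ n * d) :
    ∑ w ∈ univ.filter (fun w : Fin m → Fin n → ZMod 2 => LinearIndependent (ZMod 2) w),
      ((2 : ℝ) ^ #(nonzeroElements V ∩ nonzeroElements (Submodule.span (ZMod 2) (Set.range w))) - 1)
      ≤ m * (2 ^ (n * m) / 2 ^ (3 * m)) := by
  set I := univ.filter (fun w : Fin m → Fin n → ZMod 2 => LinearIndependent (ZMod 2) w) with hI
  let δ : (Fin m → Fin n → ZMod 2) → ℕ := fun w =>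
    Module.finrank (ZMod 2) ↥(V ⊓ Submodule.span (ZMod 2) (Set.range w))
  have h1 : ∀ w ∈ I, ((2 : ℝ) ^ #(nonzeroElements V ∩
      nonzeroElements (Submodule.span (ZMod 2) (Set.range w))) - 1) ≤
      ∑ d ∈ Icc 1 m, if δ w = d then (2 : ℝ) ^ 2 ^ d else 0 := by
    intro w _
    have hc := card_nonzeroElements (V ⊓ Submodule.span (ZMod 2) (Set.range w))
    rw [nonzeroElements_inter, sum_ite_eq]
    rcases Nat.eq_zero_or_pos (δ w) with h0 | h0
    · have h0' : Module.finrank (ZMod 2) ↥(V ⊓ Submodule.span (ZMod 2) (Set.range w)) = 0 := h0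
      rw [h0', pow_zero] at hc
      have : #(nonzeroElements (V ⊓ Submodule.span (ZMod 2) (Set.range w))) = 0 := by omega
      rw [this]
      simp only [pow_zero, sub_self]
      split_ifs <;> positivity
    · have hle : δ w ≤ m := by
        rw [← hV]
        exact Submodule.finrank_mono inf_le_left
      rw [if_pos (mem_Icc.2 ⟨h0, hle⟩)]
      have : (2 : ℝ) ^ #(nonzeroElements (V ⊓ Submodule.span (ZMod 2) (Set.range w))) ≤
          2 ^ 2 ^ δ w := pow_le_pow_right₀ (by norm_num) (by
            change _ ≤ 2 ^ Module.finrank (ZMod 2)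
              ↥(V ⊓ Submodule.span (ZMod 2) (Set.range w))
            omega)
      linarith
  refine (sum_le_sum h1).trans ?_
  rw [sum_comm]
  have h2 : ∀ d ∈ Icc 1 m, ∑ w ∈ I, (if δ w = d then (2 : ℝ) ^ 2 ^ d else 0) ≤
      2 ^ (n * m) / 2 ^ (3 * m) := by
    intro d hd
    rw [mem_Icc] at hd
    rw [← sum_filter, sum_const, nsmul_eq_mul, hI, filter_filter, le_div_iff₀ (by positivity)]
    have h3 := card_filter_finrank_inf_le (n := n) (d := d) (by simp) V hV
    have h4 := hexp d hd.1 hd.2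
    set N := #(univ.filter (fun w : Fin m → Fin n → ZMod 2 => LinearIndependent (ZMod 2) w ∧
      Module.finrank (ZMod 2) ↥(V ⊓ Submodule.span (ZMod 2) (Set.range w)) = d)) with hN
    have h5 : N * 2 ^ 2 ^ d * 2 ^ (3 * m) ≤ 2 ^ (n * m) := by
      refine Nat.le_of_mul_le_mul_right ?_ (show 0 < 2 ^ (2 * m * d) by positivity)
      calc N * 2 ^ 2 ^ d * 2 ^ (3 * m) * 2 ^ (2 * m * d)
          = N * 2 ^ (2 ^ d + 2 * m * d + 3 * m) := by
            rw [pow_add, pow_add]; ring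
        _ ≤ N * 2 ^ (n * d) := by gcongr; norm_num
        _ ≤ 2 ^ (n * m + 2 * m * d) := h3
        _ = _ := pow_add _ _ _
    exact_mod_cast h5
  calc _ ≤ ∑ d ∈ Icc 1 m, (2 : ℝ) ^ (n * m) / 2 ^ (3 * m) := sum_le_sum h2
    _ = _ := by simp

/-- With high probability, a random set avoids the nonzero elements of some subspace of
dimension `m`. -/
theorem randomSubset_real_no_free_subspace_le {n m : ℕ} (hmn : m ≤ n)
    (hexp : ∀ d, 1 ≤ d → d ≤ m → 2 ^ d + 2 * m * d + 3 * m ≤ n * d) :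
    (randomSubset n).real {A | ¬ ∃ V : Submodule (ZMod 2) (Fin n → ZMod 2),
      Module.finrank (ZMod 2) V = m ∧ ∀ w ∈ V, w ≠ 0 → w ∉ A} ≤ (1 / 2) ^ m := by
  classical
  set I := univ.filter (fun w : Fin m → Fin n → ZMod 2 => LinearIndependent (ZMod 2) w) with hI
  let C : (Fin m → Fin n → ZMod 2) → Finset (Fin n → ZMod 2) := fun w =>
    nonzeroElements (Submodule.span (ZMod 2) (Set.range w))
  have hfin : ∀ w ∈ I, Module.finrank (ZMod 2) (Submodule.span (ZMod 2) (Set.range w)) = m := by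
    intro w hw
    rw [finrank_span_eq_card (mem_filter.1 hw).2, Fintype.card_fin]
  have hC : ∀ w ∈ I, #(C w) = 2 ^ m - 1 := by
    intro w hw
    have := card_nonzeroElements (Submodule.span (ZMod 2) (Set.range w))
    rw [hfin w hw] at this
    change #(nonzeroElements _) = _
    omega
  have hmono : (randomSubset n).real {A | ¬ ∃ V : Submodule (ZMod 2) (Fin n → ZMod 2),
      Module.finrank (ZMod 2) V = m ∧ ∀ w ∈ V, w ≠ 0 → w ∉ A} ≤
      (randomSubset n).real {A | ¬ ∃ i ∈ I, ∀ w ∈ C i, w ∉ A} := by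
    refine measureReal_mono (fun A hA h => ?_) (measure_ne_top _ _)
    obtain ⟨i, hi, hiA⟩ := h
    exact hA ⟨Submodule.span (ZMod 2) (Set.range i), hfin i hi,
      fun w hw hw0 => hiA w (mem_nonzeroElements.2 ⟨hw, hw0⟩)⟩
  refine hmono.trans ?_
  have hmom := randomSubset_real_hit_all_mul_sq_le I C hC
  have hcard : (2 : ℝ) ^ (n * m) ≤ #I * 2 ^ m := by
    exact_mod_cast two_pow_le_card_linearIndependent hmn
  have hIpos : (0 : ℝ) < #I := by
    have : (0 : ℝ) < 2 ^ (n * m) := by positivity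
    nlinarith [pow_pos (show (0 : ℝ) < 2 by norm_num) m]
  -- Of the saving 2^(3m), one 2^m absorbs the number of values of d, one absorbs the tuples that
  -- are not independent, and one is the final bound.
  have hsum : ∑ i ∈ I, ∑ j ∈ I, ((2 : ℝ) ^ #(C i ∩ C j) - 1) ≤ (1 / 2) ^ m * (#I : ℝ) ^ 2 := by
    calc _ ≤ ∑ i ∈ I, (m : ℝ) * (2 ^ (n * m) / 2 ^ (3 * m)) :=
          sum_le_sum fun i hi => sum_two_pow_card_inter_le _ (hfin i hi) hexp
      _ = #I * (m * (2 ^ (n * m) / 2 ^ (3 * m))) := by rw [sum_const, nsmul_eq_mul]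
      _ ≤ #I * (2 ^ m * (#I * 2 ^ m / 2 ^ (3 * m))) := by
          gcongr
          exact_mod_cast (Nat.lt_two_pow_self (n := m)).le
      _ = (1 / 2) ^ m * (#I : ℝ) ^ 2 := by
          rw [show 3 * m = m + m + m by ring, pow_add, pow_add, one_div, inv_pow]
          field_simp
  exact le_of_mul_le_mul_right (hmom.trans hsum) (by positivity)

theorem colorable_of_free_subspace {n m : ℕ} {A : Set (Fin n → ZMod 2)}
    (V : Submodule (ZMod 2) (Fin n → ZMod 2)) (hV : Module.finrank (ZMod 2) V = m)
    (hA : ∀ w ∈ V, w ≠ 0 → w ∉ A) : (cayleySumGraph A).Colorable (2 ^ (n - m)) := by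
  classical
  let c : (cayleySumGraph A).Coloring ((Fin n → ZMod 2) ⧸ V) :=
    SimpleGraph.Coloring.mk (fun x => V.mkQ x) (by
      intro x y hxy h
      have h1 : x + y ∈ V := by
        rw [← ZModModule.sub_eq_add]
        exact (Submodule.Quotient.eq V).1 h
      refine hA _ h1 (fun h0 => hxy.1 ?_) hxy.2
      rwa [← ZModModule.sub_eq_add, sub_eq_zero] at h0)
  have hcard : Fintype.card ((Fin n → ZMod 2) ⧸ V) = 2 ^ (n - m) := by
    rw [Module.card_eq_pow_finrank (K := ZMod 2), ZMod.card]
    have := Submodule.finrank_quotient_add_finrank V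
    rw [hV, Module.finrank_fin_fun] at this
    congr 1
    omega
  rw [← hcard]
  exact c.colorable

open scoped Pointwise in
-- By pigeonhole, fewer colours force a class with more than 2^m elements, which contains a
-- forbidden X.
theorem le_of_colorable {n m N : ℕ} (hmn : m ≤ n) {A : Set (Fin n → ZMod 2)}
    (hA : ¬ ∃ X : Finset (Fin n → ZMod 2), #X = 2 ^ m + 1 ∧ ∀ w ∈ X + X, w ≠ 0 → w ∉ A)
    (hN : (cayleySumGraph A).Colorable N) : 2 ^ (n - m) ≤ N := by
  classical
  by_contra! hlt
  obtain ⟨c⟩ := hN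
  obtain ⟨i, hi⟩ := Fintype.exists_lt_card_fiber_of_mul_lt_card (f := c) (n := 2 ^ m) (by
    rw [Fintype.card_fin, Fintype.card_fun, ZMod.card, Fintype.card_fin]
    calc N * 2 ^ m < 2 ^ (n - m) * 2 ^ m := Nat.mul_lt_mul_of_pos_right hlt (by positivity)
      _ = 2 ^ n := by rw [← pow_add]; congr 1; omega)
  obtain ⟨X, hX, hXc⟩ := exists_subset_card_eq (show 2 ^ m + 1 ≤ _ from hi)
  refine hA ⟨X, hXc, ?_⟩
  intro w hw hw0 hwA
  obtain ⟨x, hx, y, hy, rfl⟩ := Finset.mem_add.1 hw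
  have hxy : (cayleySumGraph A).Adj x y := by
    refine ⟨fun h => hw0 ?_, hwA⟩
    rw [h, ZModModule.add_self]
  exact c.valid hxy ((mem_filter.1 (hX hx)).2.trans (mem_filter.1 (hX hy)).2.symm)

end FreeSubspace

/-! ### Asymptotics of the critical dimension. -/

section ConcentrationDim

theorem tendsto_logb_two_natCast : Tendsto (fun n : ℕ => Real.logb 2 n) atTop atTop :=
  (Real.tendsto_logb_atTop (by norm_num)).comp tendsto_natCast_atTop_atTop

theorem tendsto_concentrationDim : Tendsto concentrationDim atTop atTop := by
  refine tendsto_nat_floor_atTop.comp (tendsto_logb_two_natCast.atTop_add_atTop ?_)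
  exact (Real.tendsto_logb_atTop (by norm_num)).comp tendsto_logb_two_natCast

theorem tendsto_sqrt_concentrationDim :
    Tendsto (fun n => Nat.sqrt (concentrationDim n)) atTop atTop := by
  refine Tendsto.comp (g := Nat.sqrt) (tendsto_atTop.2 fun b => ?_) tendsto_concentrationDim
  filter_upwards [eventually_ge_atTop (b * b)] with m hm
  exact Nat.le_sqrt.2 hm

theorem two_pow_concentrationDim_bounds {n : ℕ} (hn : 2 ≤ n) :
    (2 : ℝ) ^ concentrationDim n ≤ n * Real.logb 2 n ∧
      n * Real.logb 2 n < 2 ^ (concentrationDim n + 1) := by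
  have h2 : (2 : ℝ) ≤ n := by exact_mod_cast hn
  have hlog : 1 ≤ Real.logb 2 n := by
    rw [Real.le_logb_iff_rpow_le (by norm_num) (by linarith)]
    simpa using h2
  have hll : 0 ≤ Real.logb 2 (Real.logb 2 n) := Real.logb_nonneg (by norm_num) hlog
  have hpos : (0 : ℝ) < n * Real.logb 2 n := by positivity
  have hmul : Real.logb 2 (n * Real.logb 2 n) = Real.logb 2 n + Real.logb 2 (Real.logb 2 n) :=
    Real.logb_mul (by positivity) (by positivity)
  constructor
  · rw [← Real.rpow_natCast, ← Real.le_logb_iff_rpow_le (by norm_num) hpos, hmul]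
    exact Nat.floor_le (by linarith)
  · rw [← Real.rpow_natCast, ← Real.logb_lt_iff_lt_rpow (by norm_num) hpos, hmul]
    push_cast
    exact Nat.lt_floor_add_one _

/-- Once log log n ≥ 3, the floor gives log n < m - 2. The spare 2n in nm covers the lower-order
terms of the second moment exponent. -/
theorem eventually_two_pow_concentrationDim_le :
    ∀ᶠ n in atTop, 2 ^ concentrationDim n ≤ n * (concentrationDim n - 2) := by
  filter_upwards [eventually_ge_atTop 2, tendsto_logb_two_natCast.eventually_ge_atTop 8,
    tendsto_concentrationDim.eventually_ge_atTop 2] with n hn hL hm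
  have h1 := (two_pow_concentrationDim_bounds hn).1
  have h3 : (3 : ℝ) ≤ Real.logb 2 (Real.logb 2 n) := by
    rw [Real.le_logb_iff_rpow_le (by norm_num) (by linarith)]
    refine le_trans (le_of_eq ?_) hL
    norm_num
  have h4 : Real.logb 2 n + Real.logb 2 (Real.logb 2 n) < concentrationDim n + 1 :=
    Nat.lt_floor_add_one _
  have h5 : (2 : ℝ) ^ concentrationDim n ≤ n * (concentrationDim n - 2) :=
    h1.trans (mul_le_mul_of_nonneg_left (by linarith) (Nat.cast_nonneg n))
  have h6 : ((concentrationDim n - 2 : ℕ) : ℝ) = concentrationDim n - 2 := by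
    rw [Nat.cast_sub hm]
    norm_num
  rw [← h6] at h5
  exact_mod_cast h5

theorem eventually_mul_concentrationDim_lt {ε : ℝ} (hε : 0 < ε) :
    ∀ᶠ n : ℕ in atTop,
      (n : ℝ) * ((1 - ε) * concentrationDim n) < 2 ^ (concentrationDim n + 1) := by
  have hlo : ∀ᶠ x : ℝ in atTop, Real.logb 2 x ≤ ε * x := by
    have h := (Real.isLittleO_log_id_atTop.bound
      (show 0 < ε * Real.log 2 by have := Real.log_pos one_lt_two; positivity))
    filter_upwards [h, eventually_ge_atTop 1] with x hx hx1
    have hl := Real.log_pos one_lt_two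
    rw [Real.norm_of_nonneg (Real.log_nonneg hx1), id, Real.norm_of_nonneg (by linarith)] at hx
    rw [Real.logb, div_le_iff₀ hl]
    linarith
  filter_upwards [eventually_ge_atTop 2, tendsto_logb_two_natCast.eventually hlo,
    tendsto_logb_two_natCast.eventually_ge_atTop 1] with n hn hL hL1
  refine lt_of_le_of_lt ?_ (two_pow_concentrationDim_bounds hn).2
  refine mul_le_mul_of_nonneg_left ?_ (Nat.cast_nonneg n)
  have hll : 0 ≤ Real.logb 2 (Real.logb 2 n) := Real.logb_nonneg (by norm_num) hL1
  have hfl : (concentrationDim n : ℝ) ≤ Real.logb 2 n + Real.logb 2 (Real.logb 2 n) :=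
    Nat.floor_le (by linarith)
  have hm0 : (0 : ℝ) ≤ concentrationDim n := Nat.cast_nonneg _
  by_cases h : 1 ≤ ε
  · nlinarith
  · nlinarith

theorem eventually_pow_le_two_pow (k : ℕ) : ∀ᶠ m : ℕ in atTop, m ^ k ≤ 2 ^ m := by
  have h := (isLittleO_pow_const_const_pow_of_one_lt (R := ℝ) k one_lt_two).bound one_pos
  filter_upwards [h] with m hm
  rw [Real.norm_of_nonneg (by positivity), Real.norm_of_nonneg (by positivity), one_mul] at hm
  exact_mod_cast hm

end ConcentrationDim

/-! ### The exceptional n have density zero. -/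

section Density

theorem card_le_of_forall_mem_Ioo {s : Finset ℕ} {a b : ℝ} (ha : 0 ≤ a) (hab : a ≤ b)
    (hs : ∀ n ∈ s, a < n ∧ (n : ℝ) < b) : (s.card : ℝ) ≤ b - a + 1 := by
  have hsub : s ⊆ Finset.Ioc ⌊a⌋₊ ⌊b⌋₊ := fun n hn =>
    Finset.mem_Ioc.2 ⟨(Nat.floor_lt ha).2 (hs n hn).1, Nat.le_floor (hs n hn).2.le⟩
  have hcard : (s.card : ℝ) ≤ (⌊b⌋₊ - ⌊a⌋₊ : ℕ) := by
    exact_mod_cast (Finset.card_le_card hsub).trans (Nat.card_Ioc _ _).le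
  rw [Nat.cast_sub (Nat.floor_mono hab)] at hcard
  have h1 := Nat.floor_le (ha.trans hab)
  have h2 := Nat.lt_floor_add_one a
  linarith

/-- Consecutive terms grow by a factor 2b/(b + 1) ≥ 3/2 once b ≥ 3, so the last term dominates. -/
theorem sum_Icc_two_pow_div_le {a b : ℕ} (ha : 3 ≤ a) (hab : a ≤ b) :
    ∑ M ∈ Finset.Icc a b, (2 : ℝ) ^ (M + 1) / M ≤ 3 * (2 ^ (b + 1) / b) := by
  induction b, hab using Nat.le_induction with
  | base =>
    rw [Finset.Icc_self, Finset.sum_singleton]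
    have : (0 : ℝ) ≤ 2 ^ (a + 1) / a := by positivity
    linarith
  | succ b hb ih =>
    rw [Finset.sum_Icc_succ_top (by omega)]
    have hb3 : (3 : ℝ) ≤ b := by exact_mod_cast ha.trans hb
    have h : 3 * ((2 : ℝ) ^ (b + 1) / b) ≤ 2 * (2 ^ (b + 1 + 1) / (b + 1 : ℕ)) := by
      push_cast
      rw [← mul_div_assoc, ← mul_div_assoc, div_le_div_iff₀ (by positivity) (by positivity),
        pow_succ _ (b + 1)]
      have : (0 : ℝ) < 2 ^ (b + 1) := by positivity
      nlinarith
    linarith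

theorem eventually_one_le_mul_two_pow_div {ε : ℝ} (hε : 0 < ε) :
    ∀ᶠ M : ℕ in atTop, 1 ≤ ε * ((2 : ℝ) ^ (M + 1) / M) := by
  have h := (isLittleO_pow_const_const_pow_of_one_lt (R := ℝ) 1 one_lt_two).bound hε
  filter_upwards [h, eventually_ge_atTop 1] with M hM hM1
  have hM' : (1 : ℝ) ≤ M := by exact_mod_cast hM1
  rw [Real.norm_of_nonneg (by positivity), Real.norm_of_nonneg (by positivity), pow_one] at hM
  rw [← mul_div_assoc, le_div_iff₀ (by linarith), pow_succ]
  have : 0 < ε * 2 ^ M := by positivity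
  linarith

/-- A set of integers `n` all but finitely many of which satisfy `n * d n ≈ 2 ^ (d n + 1)`, where
`d n → ∞`, has density zero. -/
theorem tendsto_ncard_div_of_forall_eventually {T : Set ℕ} {d : ℕ → ℕ}
    (hd : Tendsto d atTop atTop)
    (hT : ∀ ε : ℝ, 0 < ε → ∀ᶠ n : ℕ in atTop, n ∈ T →
      (n : ℝ) * ((1 - ε) * d n) < 2 ^ (d n + 1) ∧ 2 ^ (d n + 1) < (n : ℝ) * ((1 + ε) * d n)) :
    Tendsto (fun N : ℕ => ((T ∩ Set.Icc 1 N).ncard : ℝ) / N) atTop (𝓝 0) := by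
  classical
  have key : ∀ ε : ℝ, 0 < ε → ε ≤ 1 / 2 → ∃ C : ℝ, ∀ N : ℕ,
      ((T ∩ Set.Icc 1 N).ncard : ℝ) ≤ C + 24 * ε * N := by
    intro ε hε hε2
    obtain ⟨D, hD⟩ := eventually_atTop.1 (eventually_one_le_mul_two_pow_div hε)
    obtain ⟨n₀, hn₀⟩ := eventually_atTop.1 ((hT ε hε).and (hd.eventually_ge_atTop (max D 3)))
    refine ⟨n₀, fun N => ?_⟩
    set B : Finset ℕ := (Finset.Icc n₀ N).filter (· ∈ T) with hB
    have hsub : T ∩ Set.Icc 1 N ⊆ ((Finset.range n₀ ∪ B : Finset ℕ) : Set ℕ) := by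
      rintro n ⟨hnT, -, hnN⟩
      rw [Finset.mem_coe, Finset.mem_union, Finset.mem_range, hB, Finset.mem_filter,
        Finset.mem_Icc]
      by_cases h : n < n₀
      · exact Or.inl h
      · exact Or.inr ⟨⟨by omega, hnN⟩, hnT⟩
    have h1 : ((T ∩ Set.Icc 1 N).ncard : ℝ) ≤ n₀ + B.card := by
      have h2 := Set.ncard_le_ncard hsub (Finset.finite_toSet _)
      rw [Set.ncard_coe_finset] at h2
      have h3 := h2.trans (Finset.card_union_le _ _)
      rw [Finset.card_range] at h3
      exact_mod_cast h3
    refine h1.trans (add_le_add le_rfl ?_)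
    rcases B.eq_empty_or_nonempty with h0 | hne
    · rw [h0, Finset.card_empty, Nat.cast_zero]
      positivity
    have hmem : ∀ n ∈ B, (n : ℝ) * ((1 - ε) * d n) < 2 ^ (d n + 1) ∧
        2 ^ (d n + 1) < (n : ℝ) * ((1 + ε) * d n) ∧ max D 3 ≤ d n ∧ n ≤ N := by
      intro n hn
      rw [hB, Finset.mem_filter, Finset.mem_Icc] at hn
      have h := hn₀ n hn.1.1
      exact ⟨(h.1 hn.2).1, (h.1 hn.2).2, h.2, hn.1.2⟩
    obtain ⟨n₁, hn₁, hmax⟩ := B.exists_max_image d hne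
    -- The n with d n = M fill a window of length at most 3ε * 2^(M+1)/M, and rounding costs one
    -- more ε-multiple. The geometric sum contributes a factor 3 and 2^(d n₁ + 1)/d n₁ ≤ 2N a factor
    -- 2, giving 24.
    have hcount : ∀ M ∈ Finset.Icc (max D 3) (d n₁),
        ((B.filter fun n => d n = M).card : ℝ) ≤ 4 * ε * (2 ^ (M + 1) / M) := by
      intro M hM
      rw [Finset.mem_Icc] at hM
      have hM3 : (3 : ℝ) ≤ M := by exact_mod_cast (le_max_right _ _).trans hM.1
      have hpos : (0 : ℝ) < 2 ^ (M + 1) / M := by positivity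
      have h1ε : 0 < 1 - ε := by linarith
      have h := card_le_of_forall_mem_Ioo (s := B.filter fun n => d n = M)
        (a := 2 ^ (M + 1) / M / (1 + ε)) (b := 2 ^ (M + 1) / M / (1 - ε)) (by positivity)
        (div_le_div_of_nonneg_left hpos.le h1ε (by linarith)) ?_
      · have h2 := hD M ((le_max_left _ _).trans hM.1)
        have h3 : (2 : ℝ) ^ (M + 1) / M / (1 - ε) - 2 ^ (M + 1) / M / (1 + ε) ≤
            3 * ε * (2 ^ (M + 1) / M) := by
          rw [div_sub_div _ _ h1ε.ne' (by positivity), div_le_iff₀ (by positivity)]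
          have h4 : 0 ≤ 2 ^ (M + 1) / M * ε * (1 - 3 * ε ^ 2) :=
            mul_nonneg (by positivity) (by nlinarith)
          nlinarith
        linarith
      · intro n hn
        rw [Finset.mem_filter] at hn
        obtain ⟨hnB, rfl⟩ := hn
        have h5 := hmem n hnB
        rw [div_div, div_div, div_lt_iff₀ (by positivity), lt_div_iff₀ (by positivity)]
        exact ⟨by linarith [h5.2.1], by linarith [h5.1]⟩
    have hsum : (B.card : ℝ) ≤ ∑ M ∈ Finset.Icc (max D 3) (d n₁),
        4 * ε * ((2 : ℝ) ^ (M + 1) / M) := by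
      rw [Finset.card_eq_sum_card_fiberwise (f := d) (t := Finset.Icc (max D 3) (d n₁))
        (fun n hn => Finset.mem_coe.2 (Finset.mem_Icc.2 ⟨(hmem n hn).2.2.1, hmax n hn⟩))]
      push_cast
      exact Finset.sum_le_sum hcount
    rw [← Finset.mul_sum] at hsum
    obtain ⟨-, h6, h7, h8⟩ := hmem n₁ hn₁
    have h9 := sum_Icc_two_pow_div_le (le_max_right D 3) h7
    have hd3 : (3 : ℝ) ≤ d n₁ := by exact_mod_cast (le_max_right _ _).trans h7
    have h10 : (2 : ℝ) ^ (d n₁ + 1) / d n₁ ≤ 2 * N := by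
      rw [div_le_iff₀ (by linarith)]
      have h11 : (n₁ : ℝ) ≤ N := by exact_mod_cast h8
      have h12 : (n₁ : ℝ) * ((1 + ε) * d n₁) ≤ N * (2 * d n₁) := by
        gcongr
        linarith
      linarith
    nlinarith
  rw [Metric.tendsto_atTop]
  intro δ hδ
  obtain ⟨C, hC⟩ := key (min (1 / 2) (δ / 48)) (by positivity) (min_le_left _ _)
  obtain ⟨N₀, hN₀⟩ := exists_nat_gt (2 * C / δ)
  refine ⟨max N₀ 1, fun N hN => ?_⟩
  have hN1 : (1 : ℝ) ≤ N := by exact_mod_cast (le_max_right _ _).trans hN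
  have hNN : (N₀ : ℝ) ≤ N := by exact_mod_cast (le_max_left _ _).trans hN
  rw [Real.dist_eq, sub_zero, abs_of_nonneg (by positivity), div_lt_iff₀ (by linarith)]
  have h1 := hC N
  have h2 : 24 * min (1 / 2) (δ / 48) * N ≤ δ / 2 * N := by
    gcongr
    linarith [min_le_right (1 / 2) (δ / 48)]
  have h3 : 2 * C < N * δ := by
    rw [← div_lt_iff₀ hδ]
    linarith
  linarith

theorem HasNaturalDensity.of_compl {S T : Set ℕ} {n₀ : ℕ}
    (hT : Tendsto (fun N : ℕ => ((T ∩ Set.Icc 1 N).ncard : ℝ) / N) atTop (𝓝 0))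
    (hST : ∀ n, n₀ ≤ n → n ∉ T → n ∈ S) : HasNaturalDensity S 1 := by
  have hlow : Tendsto (fun N : ℕ => 1 - (n₀ : ℝ) / N - ((T ∩ Set.Icc 1 N).ncard : ℝ) / N) atTop
      (𝓝 1) := by
    have h := (tendsto_const_nhds (x := (1 : ℝ))).sub (tendsto_const_div_atTop_nhds_zero_nat (n₀ : ℝ))
    simpa using h.sub hT
  have hcard : ∀ N, (Set.Icc 1 N).ncard = N := fun N => by
    rw [Set.ncard_eq_toFinset_card', Set.toFinset_Icc, Nat.card_Icc, Nat.add_sub_cancel]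
  refine tendsto_of_tendsto_of_tendsto_of_le_of_le' hlow tendsto_const_nhds ?_ ?_
  · filter_upwards [eventually_ge_atTop 1] with N hN
    have hN' : (0 : ℝ) < N := by exact_mod_cast hN
    have hsub : Set.Icc 1 N ⊆ (S ∩ Set.Icc 1 N) ∪ ((T ∩ Set.Icc 1 N) ∪ Set.Iio n₀) := by
      intro n hn
      by_cases h : n₀ ≤ n
      · by_cases hnT : n ∈ T
        · exact Or.inr (Or.inl ⟨hnT, hn⟩)
        · exact Or.inl ⟨hST n h hnT, hn⟩
      · exact Or.inr (Or.inr (not_le.1 h))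
    have hfin : ∀ U : Set ℕ, (U ∩ Set.Icc 1 N).Finite := fun U =>
      (Set.finite_Icc 1 N).subset Set.inter_subset_right
    have h1 := Set.ncard_le_ncard hsub
      ((hfin S).union ((hfin T).union (Set.finite_Iio n₀)))
    have h2 := Set.ncard_union_le (S ∩ Set.Icc 1 N) ((T ∩ Set.Icc 1 N) ∪ Set.Iio n₀)
    have h3 := Set.ncard_union_le (T ∩ Set.Icc 1 N) (Set.Iio n₀)
    have h4 : (Set.Iio n₀).ncard = n₀ := by
      rw [Set.ncard_eq_toFinset_card', Set.toFinset_Iio, Nat.card_Iio]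
    rw [hcard] at h1
    have h5 : (N : ℝ) ≤ (S ∩ Set.Icc 1 N).ncard + (T ∩ Set.Icc 1 N).ncard + n₀ := by
      exact_mod_cast (by omega : N ≤ (S ∩ Set.Icc 1 N).ncard + (T ∩ Set.Icc 1 N).ncard + n₀)
    rw [one_sub_div hN'.ne', ← sub_div]
    gcongr
    linarith
  · filter_upwards [eventually_ge_atTop 1] with N hN
    have hN' : (0 : ℝ) < N := by exact_mod_cast hN
    rw [div_le_one hN']
    have h := Set.ncard_le_ncard (Set.inter_subset_right (s := S)) (Set.finite_Icc 1 N)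
    rw [hcard] at h
    exact_mod_cast h

theorem HasNaturalDensity.infinite {S : Set ℕ} (hS : HasNaturalDensity S 1) : S.Infinite := by
  intro hfin
  have hzero : Tendsto (fun N : ℕ => ((S ∩ Set.Icc 1 N).ncard : ℝ) / N) atTop (𝓝 0) := by
    refine tendsto_of_tendsto_of_tendsto_of_le_of_le tendsto_const_nhds
      (tendsto_const_div_atTop_nhds_zero_nat (S.ncard : ℝ)) (fun N => by positivity) fun N => ?_
    exact div_le_div_of_nonneg_right
      (Nat.cast_le.2 (Set.ncard_le_ncard Set.inter_subset_left hfin)) (Nat.cast_nonneg N)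
  exact one_ne_zero (tendsto_nhds_unique hS hzero)

/-- Because c√m ≤ εm eventually, a failure of the gap puts n * m within a factor 1 ± ε of 2^(m+1).
-/
theorem hasNaturalDensity_gap (c : ℕ) :
    HasNaturalDensity {n : ℕ | 2 ≤ n ∧
      n * (concentrationDim n + c * Nat.sqrt (concentrationDim n)) ≤
        2 ^ (concentrationDim n + 1)} 1 := by
  refine HasNaturalDensity.of_compl (n₀ := 2)
    (T := {n | 2 ^ (concentrationDim n + 1) <
      n * (concentrationDim n + c * Nat.sqrt (concentrationDim n))})
    (tendsto_ncard_div_of_forall_eventually tendsto_concentrationDim ?_)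
    fun n hn hnT => ⟨hn, not_lt.1 hnT⟩
  intro ε hε
  obtain ⟨b, hb⟩ := exists_nat_gt (c / ε)
  filter_upwards [eventually_mul_concentrationDim_lt hε,
    tendsto_sqrt_concentrationDim.eventually_ge_atTop b] with n h1 h2 hn
  refine ⟨h1, ?_⟩
  have hn' : (2 : ℝ) ^ (concentrationDim n + 1) <
      n * (concentrationDim n + c * Nat.sqrt (concentrationDim n)) := by
    exact_mod_cast (show 2 ^ (concentrationDim n + 1) < _ from hn)
  refine hn'.trans_le (mul_le_mul_of_nonneg_left ?_ (Nat.cast_nonneg n))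
  have h3 : (Nat.sqrt (concentrationDim n) : ℝ) * Nat.sqrt (concentrationDim n) ≤
      concentrationDim n := by exact_mod_cast Nat.sqrt_le _
  have h4 : (c : ℝ) ≤ ε * Nat.sqrt (concentrationDim n) := by
    rw [div_lt_iff₀ hε] at hb
    have : (b : ℝ) ≤ Nat.sqrt (concentrationDim n) := by exact_mod_cast h2
    nlinarith
  have h5 := mul_le_mul_of_nonneg_right h4
    (Nat.cast_nonneg (α := ℝ) (Nat.sqrt (concentrationDim n)))
  nlinarith

end Density

/-! ### The chromatic number. -/

section ChromaticNumber

theorem mul_two_pow_le_mul_two_pow {d m : ℕ} (hd : 1 ≤ d) (hdm : d ≤ m) :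
    m * 2 ^ d ≤ d * 2 ^ m := by
  induction m, hdm using Nat.le_induction with
  | base => exact le_rfl
  | succ k hk ih =>
    have h1 : 2 ^ d ≤ 2 ^ k := Nat.pow_le_pow_right (by norm_num) hk
    have h2 : 2 ^ k ≤ d * 2 ^ k := Nat.le_mul_of_pos_left _ hd
    rw [pow_succ]
    linarith

/-- On integers 1 ≤ d ≤ m the ratio 2^d/d is greatest at d = m, so 2^d ≤ nd(m - 2)/m. The leftover
2nd/m exceeds the linear terms because n ≥ 5m^2. -/
theorem moment_exponent_le {n m : ℕ} (hm : 3 ≤ m) (hn : 2 ^ m ≤ n * (m - 2))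
    (hmn : 5 * m ^ 2 ≤ n) {d : ℕ} (hd : 1 ≤ d) (hdm : d ≤ m) :
    2 ^ d + 2 * m * d + 3 * m ≤ n * d := by
  have hmul := mul_two_pow_le_mul_two_pow hd hdm
  obtain ⟨k, rfl⟩ : ∃ k, m = k + 2 := ⟨m - 2, by omega⟩
  rw [Nat.add_sub_cancel] at hn
  refine Nat.le_of_mul_le_mul_left ?_ (show 0 < k + 2 by omega)
  have h1 : d * 2 ^ (k + 2) ≤ d * (n * k) := Nat.mul_le_mul_left _ hn
  have h2 : 5 * (k + 2) ^ 2 * d ≤ n * d := Nat.mul_le_mul_right _ hmn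
  have h3 : (k + 2) ^ 2 ≤ (k + 2) ^ 2 * d := Nat.le_mul_of_pos_right _ hd
  nlinarith

theorem randomSubset_real_chromaticNumber_ge {n m q : ℕ} (hq : 2000 ≤ q) (hqm : q * q ≤ m)
    (hqm' : m < (q + 1) * (q + 1)) (hmn : m ≤ n) (hn : 2 ^ m ≤ n * (m - 2))
    (hpow : m ^ 40 ≤ 2 ^ m) (hgap : n * (m + 4000 * q) ≤ 2 ^ (m + 1)) :
    1 - (6 * (1 / 2) ^ n + (1 / 2) ^ m) ≤ (randomSubset n).real
      {A | (cayleySumGraph A).chromaticNumber = ((2 ^ (n - m) : ℕ) : ℕ∞)} := by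
  have hm : 10000 ≤ m := by nlinarith
  have hnm : 2 ^ m ≤ n * m := hn.trans (Nat.mul_le_mul_left _ (Nat.sub_le _ _))
  have hn5 : 5 * m ^ 2 ≤ n := by
    refine Nat.le_of_mul_le_mul_right ?_ (show 0 < m by omega)
    calc 5 * m ^ 2 * m ≤ m * m ^ 2 * m :=
          Nat.mul_le_mul_right _ (Nat.mul_le_mul_right _ (by omega))
      _ = m ^ 4 := by ring
      _ ≤ m ^ 40 := Nat.pow_le_pow_right (by omega) (by norm_num)
      _ ≤ n * m := hpow.trans hnm
  have hlow := randomSubset_real_exists_sum_free_le hq hqm hqm' hnm hpow hgap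
  have hup := randomSubset_real_no_free_subspace_le hmn
    fun d hd hdm => moment_exponent_le (by omega) hn hn5 hd hdm
  set E := {A : Set (Fin n → ZMod 2) |
    (cayleySumGraph A).chromaticNumber = ((2 ^ (n - m) : ℕ) : ℕ∞)} with hE
  have hcompl : (randomSubset n).real Eᶜ ≤ 6 * (1 / 2) ^ n + (1 / 2) ^ m := by
    refine le_trans ?_ ((measureReal_union_le _ _).trans (add_le_add hlow hup))
    refine measureReal_mono (fun A hA => ?_) (measure_ne_top _ _)
    by_contra hc
    rw [Set.mem_union, not_or] at hc
    obtain ⟨hX, hV⟩ := hc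
    obtain ⟨V, hV, hVA⟩ := not_not.1 hV
    refine hA (le_antisymm
      (SimpleGraph.chromaticNumber_le_iff_colorable.2 (colorable_of_free_subspace V hV hVA)) ?_)
    refine SimpleGraph.le_chromaticNumber_iff_colorable.2 fun N hN => ?_
    exact_mod_cast le_of_colorable hmn hX hN
  rw [probReal_compl_eq_one_sub (Set.toFinite _).measurableSet] at hcompl
  linarith

theorem tendsto_randomSubset_real_chromaticNumber {u : ℕ → ℕ} (hu : Tendsto u atTop atTop)
    (hgap : ∀ l, u l * (concentrationDim (u l) + 4000 * Nat.sqrt (concentrationDim (u l))) ≤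
      2 ^ (concentrationDim (u l) + 1)) :
    Tendsto
      (fun l : ℕ => (randomSubset (u l)).real
        {A | (cayleySumGraph A).chromaticNumber =
          ((2 ^ (u l - concentrationDim (u l)) : ℕ) : ℕ∞)})
      atTop (𝓝 1) := by
  have hpow : Tendsto (fun n : ℕ => ((1 : ℝ) / 2) ^ n) atTop (𝓝 0) :=
    tendsto_pow_atTop_nhds_zero_of_lt_one (by norm_num) (by norm_num)
  have herr : Tendsto (fun l => 1 - (6 * ((1 : ℝ) / 2) ^ u l + (1 / 2) ^ concentrationDim (u l)))
      atTop (𝓝 1) := by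
    simpa using tendsto_const_nhds.sub (((hpow.comp hu).const_mul 6).add
      (hpow.comp (tendsto_concentrationDim.comp hu)))
  refine tendsto_of_tendsto_of_tendsto_of_le_of_le' herr tendsto_const_nhds ?_
    (Eventually.of_forall fun l => measureReal_le_one)
  filter_upwards [hu.eventually (eventually_ge_atTop 2),
    hu.eventually eventually_two_pow_concentrationDim_le,
    hu.eventually (tendsto_concentrationDim.eventually (eventually_pow_le_two_pow 40)),
    hu.eventually (tendsto_sqrt_concentrationDim.eventually_ge_atTop 2000)] with l h2 hm hm40 hq
  exact randomSubset_real_chromaticNumber_ge hq (Nat.sqrt_le _) (Nat.sqrt_lt'.1 (Nat.lt_succ_self _) |>.trans_eq (pow_two _))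
    (concentrationDim_spec _ h2).2 hm hm40 (hgap l)

theorem theorem4 :
    ∃ u : ℕ → ℕ, StrictMono u ∧ (∀ l, 2 ≤ u l) ∧ HasNaturalDensity (Set.range u) 1 ∧
      Tendsto
        (fun l : ℕ => (randomSubset (u l)).real
          {A | (cayleySumGraph A).chromaticNumber =
            ((2 ^ (u l - concentrationDim (u l)) : ℕ) : ℕ∞)})
        atTop (𝓝 1) := by
  set S := {n : ℕ | 2 ≤ n ∧
    n * (concentrationDim n + 4000 * Nat.sqrt (concentrationDim n)) ≤
      2 ^ (concentrationDim n + 1)} with hS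
  have hdens : HasNaturalDensity S 1 := hasNaturalDensity_gap 4000
  have hinf := hdens.infinite
  have hmem : ∀ l, Nat.nth (· ∈ S) l ∈ S := fun l => Nat.nth_mem_of_infinite hinf l
  refine ⟨Nat.nth (· ∈ S), Nat.nth_strictMono hinf, fun l => (hmem l).1, ?_, ?_⟩
  · exact (Nat.range_nth_of_infinite (p := (· ∈ S)) hinf).symm ▸ hdens
  · exact tendsto_randomSubset_real_chromaticNumber (Nat.nth_strictMono hinf).tendsto_atTop
      fun l => (hmem l).2

end ChromaticNumber
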